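/- Let $n\ge 1$, let $\mathcal{C}l_n$ be the real Clifford algebra generated by $e_1,\dots,e_n$ with $x^2=-\|x\|^2$ for $x\in\mathbb{R}^n$, and identify $x=(x_0,\dots,x_n)\in\mathbb{R}^{n+1}$ with $x_0+\sum_{j=1}^n x_je_j\in\mathcal{C}l_n$; write $\overline{x}=x_0-\sum_{j=1}^n x_je_j$ and $e_0=1$. Let $\mathbb{S}^n\subset\mathbb{R}^{n+1}$ be the unit sphere with surface measure $dv$, and let $\omega_n=2\pi^{n/2}/\Gamma(n/2)$ be the area of the unit sphere of $\mathbb{R}^n$. For $f\in C^1(\mathbb{S}^n,\mathcal{C}l_n)$ and $w\in\mathbb{S}^n$ put $$Tf(w)=\frac1{\omega_n}\int_{\mathbb{S}^n}\frac{\overline{w-v}}{\|w-v\|^n}f(v)\,dv,\qquad \Pi_{s,0}f(w)=(\overline{D_s}+\overline{w})Tf(w),\qquad \overline{D_s}=\overline{w}\Big(\overline{\Gamma_0}-\frac n2\Big),$$ $$\overline{\Gamma_0}=-\sum_{j=1}^n e_0e_j(x_0\partial_{x_j}-x_j\partial_{x_0})-\sum_{1\le i<j\le n}e_ie_j(x_i\partial_{x_j}-x_j\partial_{x_i}),$$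 where $\overline{\Gamma_0}$, which only differentiates along the sphere, is evaluated on the extension of $Tf$ that is constant on rays. Then, for every $f\in C^1(\mathbb{S}^n,\mathcal{C}l_n)$ and every $w\in\mathbb{S}^n$, the integral $Tf(w)$ converges absolutely, the extension of $Tf$ that is constant on rays is differentiable at $w$, and the following hold. (1) With $\overline{D}=\partial_{x_0}-\sum_{j=1}^n e_j\partial_{x_j}$ and $E=\sum_{j=0}^n x_j\partial_{x_j}$, computed on any extension of $Tf$ to $\mathbb{R}^{n+1}$ that is differentiable at $w$, $$\Pi_{s,0}f(w)=\Big(\overline{D}\,T+\overline{w}(1-E)T-\frac n2\,\overline{w}\,T\Big)f(w).$$ (2) For every $\varepsilon>0$ the two truncated integrals below converge absolutely, the limit exists, and $$\Pi_{s,0}f(w)=\lim_{\varepsilon\to0^+}\left[\frac1{\omega_n}\int_{\|w-v\|>\varepsilon}\frac{1-n-\overline{w}^2}{\|w-v\|^n}f(v)\,dv+\frac n{\omega_n}\int_{\|w-v\|>\varepsilon}\frac{\overline{v}-\langle w,v\rangle\overline{w}}{\|w-v\|^{n+1}}\cdot\frac{\overline{w-v}}{\|w-v\|}f(v)\,dv\right]$$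 $$\qquad+\Big(1-\frac n2\Big)\frac{\overline{w}}{\omega_n}\int_{\mathbb{S}^n}\frac{\overline{w-v}}{\|w-v\|^n}f(v)\,dv+\frac{1-n-\overline{w}^2}{n}f(w).$$ -/

import Mathlib

open scoped Manifold ContDiff Topology

noncomputable section

namespace SphericalPi

/-- The Euclidean space `ℝ^{n+1}`, with coordinates `x₀, x₁, …, xₙ`. -/
abbrev Ambient (n : ℕ) : Type := EuclideanSpace ℝ (Fin (n + 1))

/-- The unit sphere `𝕊ⁿ` of `ℝ^{n+1}`. -/
abbrev Sph (n : ℕ) : Type := Metric.sphere (0 : Ambient n) 1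

/-- The quadratic form `x ↦ -‖x‖²` on `ℝⁿ`. -/
def cliffordForm (n : ℕ) : QuadraticForm ℝ (Fin n → ℝ) :=
  QuadraticMap.weightedSumSquares ℝ (fun _ : Fin n => (-1 : ℝ))

/-- The real Clifford algebra with `n` generators and `x² = -‖x‖²`. -/
abbrev Cl (n : ℕ) : Type := CliffordAlgebra (cliffordForm n)

/-- The generators; `e n j` is the one usually written `e_{j+1}`. -/
def e (n : ℕ) (j : Fin n) : Cl n := CliffordAlgebra.ι (cliffordForm n) (Pi.single j 1)

/-- The basis `e_A`, `A ⊆ {1, …, n}`, obtained by transporting the standard basis of the exterior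
algebra; `clBasis_apply` says that it consists of the ordered products of generators. -/
def clBasis (n : ℕ) : Module.Basis (Finset (Fin n)) ℝ (Cl n) :=
  (Pi.basisFun ℝ (Fin n)).ExteriorAlgebra.map
    (CliffordAlgebra.equivExterior (cliffordForm n)).symm

theorem associated_cliffordForm_single (n : ℕ) {i j : Fin n} (h : i ≠ j) :
    QuadraticMap.associated (R := ℝ) (-cliffordForm n)
      (Pi.single i (1 : ℝ)) (Pi.single j (1 : ℝ)) = 0 := by
  have h' : ∀ x : Fin n, ((Pi.single i (1 : ℝ) : Fin n → ℝ) x + (Pi.single j (1 : ℝ) : Fin n → ℝ) x)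
      * ((Pi.single i (1 : ℝ) : Fin n → ℝ) x + (Pi.single j (1 : ℝ) : Fin n → ℝ) x)
      = (Pi.single i (1 : ℝ) : Fin n → ℝ) x * (Pi.single i (1 : ℝ) : Fin n → ℝ) x
      + (Pi.single j (1 : ℝ) : Fin n → ℝ) x * (Pi.single j (1 : ℝ) : Fin n → ℝ) x := by
    intro x
    by_cases hi : x = i
    · subst hi; simp [Pi.single_eq_of_ne h]
    · simp [Pi.single_eq_of_ne hi]
  simp only [QuadraticMap.associated_apply, cliffordForm, neg_apply,
    QuadraticMap.weightedSumSquares_apply, Pi.add_apply, h']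
  simp [Finset.sum_add_distrib]

theorem contractLeft_prod_eq_zero {n : ℕ} (d : Module.Dual ℝ (Fin n → ℝ)) (l : List (Fin n))
    (h : ∀ i ∈ l, d (Pi.single i 1) = 0) :
    CliffordAlgebra.contractLeft (Q := (0 : QuadraticForm ℝ (Fin n → ℝ))) d
      (l.map fun i => CliffordAlgebra.ι (0 : QuadraticForm ℝ (Fin n → ℝ)) (Pi.single i 1)).prod
      = 0 := by
  induction l with
  | nil => simp
  | cons i l ih =>
    rw [List.map_cons, List.prod_cons, CliffordAlgebra.contractLeft_ι_mul, h i (by simp),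
      ih fun k hk => h k (by simp [hk])]
    simp

theorem equivExterior_prod {n : ℕ} (l : List (Fin n)) (h : l.Nodup) :
    CliffordAlgebra.equivExterior (cliffordForm n) (l.map (e n)).prod
      = (l.map fun i => ExteriorAlgebra.ι ℝ (Pi.single i (1 : ℝ) : Fin n → ℝ)).prod := by
  induction l with
  | nil => simp
  | cons i l ih =>
    have ih' := ih h.of_cons
    rw [CliffordAlgebra.equivExterior, CliffordAlgebra.changeFormEquiv_apply] at ih' ⊢
    rw [List.map_cons, List.prod_cons, e, CliffordAlgebra.changeForm_ι_mul, ih']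
    have h0 := contractLeft_prod_eq_zero
      (QuadraticMap.associated (R := ℝ) (-cliffordForm n) (Pi.single i (1 : ℝ))) l
      (fun k hk => associated_cliffordForm_single n (by
        rintro rfl
        exact (List.nodup_cons.mp h).1 hk))
    simp only [List.map_cons, List.prod_cons]
    exact (sub_eq_self (a := (_ : ExteriorAlgebra ℝ (Fin n → ℝ)))).mpr h0

theorem clBasis_apply (n : ℕ) (A : Finset (Fin n)) :
    clBasis n A = ((A.sort (· ≤ ·)).map (e n)).prod := by
  rw [clBasis, Module.Basis.map_apply, LinearEquiv.symm_apply_eq,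
    equivExterior_prod _ (Finset.sort_nodup _ _), ExteriorAlgebra.basis_apply]
  change (List.ofFn _).prod = _
  congr 1
  refine List.ext_getElem (by simp) fun i h₁ h₂ => ?_
  simp [Set.powersetCard.ofFinEmbEquiv_symm_apply, Finset.orderEmbOfFin_apply]

/-- The components `(x_A)_A` of a Clifford number. -/
def components (n : ℕ) : Cl n →ₗ[ℝ] EuclideanSpace ℝ (Finset (Fin n)) :=
  (WithLp.linearEquiv 2 ℝ (Finset (Fin n) → ℝ)).symm.toLinearMap ∘ₗ (clBasis n).equivFun.toLinearMap

theorem components_injective (n : ℕ) : Function.Injective (components n) :=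
  (WithLp.linearEquiv 2 ℝ (Finset (Fin n) → ℝ)).symm.injective.comp (clBasis n).equivFun.injective

/-- The norm `‖x‖² = ∑_A x_A²` on the Clifford algebra. -/
instance instNormedAddCommGroupCl (n : ℕ) : NormedAddCommGroup (Cl n) :=
  NormedAddCommGroup.induced (Cl n) (EuclideanSpace ℝ (Finset (Fin n))) (components n)
    (components_injective n)

instance instNormedSpaceCl (n : ℕ) : NormedSpace ℝ (Cl n) :=
  NormedSpace.induced ℝ (Cl n) (EuclideanSpace ℝ (Finset (Fin n))) (components n)

instance instFiniteDimensionalCl (n : ℕ) : FiniteDimensional ℝ (Cl n) :=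
  (clBasis n).finiteDimensional_of_finite

instance instCompleteSpaceCl (n : ℕ) : CompleteSpace (Cl n) :=
  FiniteDimensional.complete ℝ (Cl n)

/-- The identification of `x ∈ ℝ^{n+1}` with the paravector `x₀ + ∑_{j=1}^n x_j e_j`. -/
def paravector {n : ℕ} (x : Ambient n) : Cl n :=
  algebraMap ℝ (Cl n) (x 0) + ∑ j : Fin n, x j.succ • e n j

/-- The conjugate `x̄ = x₀ - ∑_{j=1}^n x_j e_j` of the paravector `x`. -/
def conj {n : ℕ} (x : Ambient n) : Cl n := CliffordAlgebra.involute (paravector x)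

/-- The surface measure on `𝕊ⁿ`. -/
def surface (n : ℕ) : MeasureTheory.Measure (Sph n) :=
  (MeasureTheory.volume : MeasureTheory.Measure (Ambient n)).toSphere

/-- `ω_n = 2 π^{n/2} / Γ(n/2)`, the area of the unit sphere of `ℝⁿ`. -/
def omega (n : ℕ) : ℝ := 2 * Real.pi ^ ((n : ℝ) / 2) / Real.Gamma ((n : ℝ) / 2)

/-- The spherical Cauchy kernel `G_s(x) = x̄ / ‖x‖ⁿ`, to be evaluated at `x = w - v`. -/
def cauchyKernel {n : ℕ} (x : Ambient n) : Cl n := (‖x‖ ^ n)⁻¹ • conj x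

/-- The Cauchy transform `T f(w) = ω_n⁻¹ ∫_{𝕊ⁿ} G_s(w - v) f(v) dv`. -/
def cauchyT {n : ℕ} (f : Sph n → Cl n) (w : Sph n) : Cl n :=
  (omega n)⁻¹ • ∫ v : Sph n, cauchyKernel ((w : Ambient n) - (v : Ambient n)) * f v ∂(surface n)

/-- The extension of a function on `𝕊ⁿ` to `ℝ^{n+1} ∖ {0}` that is constant on rays. -/
def radialExt {n : ℕ} (g : Sph n → Cl n) (x : Ambient n) : Cl n :=
  if hx : x = 0 then 0
  else g ⟨‖x‖⁻¹ • x, by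
    rw [mem_sphere_zero_iff_norm, norm_smul, norm_inv, norm_norm,
      inv_mul_cancel₀ (norm_ne_zero_iff.mpr hx)]⟩

/-- The partial derivative `∂_{x_i} F(x)`. -/
def partialDeriv {n : ℕ} (i : Fin (n + 1)) (F : Ambient n → Cl n) (x : Ambient n) : Cl n :=
  fderiv ℝ F x (EuclideanSpace.single i 1)

/-- `D̄₀ = ∂_{x₀} - ∑_{j=1}^n e_j ∂_{x_j}`. -/
def diracBar {n : ℕ} (F : Ambient n → Cl n) (x : Ambient n) : Cl n :=
  partialDeriv 0 F x - ∑ j : Fin n, e n j * partialDeriv j.succ F x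

/-- The Euler operator `E = ∑_{j=0}^n x_j ∂_{x_j}`. -/
def euler {n : ℕ} (F : Ambient n → Cl n) (x : Ambient n) : Cl n :=
  ∑ i : Fin (n + 1), x i • partialDeriv i F x

/-- `Γ̄₀ = -∑_{j=1}^n e₀e_j (x₀∂_{x_j} - x_j∂_{x₀}) - ∑_{i<j} e_ie_j (x_i∂_{x_j} - x_j∂_{x_i})`,
where `e₀ = 1`. -/
def gammaBar {n : ℕ} (F : Ambient n → Cl n) (x : Ambient n) : Cl n :=
  - ∑ j : Fin n, e n j * (x 0 • partialDeriv j.succ F x - x j.succ • partialDeriv 0 F x)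
  - ∑ i : Fin n, ∑ j ∈ Finset.Ioi i, e n i * e n j *
      (x i.succ • partialDeriv j.succ F x - x j.succ • partialDeriv i.succ F x)

/-- The conjugate conformally invariant spherical Dirac operator `D̄_s = w̄ (Γ̄₀ - n/2)`. The
operator `Γ̄₀` only differentiates along the sphere, so it may be computed on any differentiable
extension; the one that is constant on rays is used. -/
def diracSBar {n : ℕ} (g : Sph n → Cl n) (w : Sph n) : Cl n :=
  conj (w : Ambient n) * (gammaBar (radialExt g) w - ((n : ℝ) / 2) • g w)

/-- The spherical `Π`-type operator `Π_{s,0} f = (D̄_s + w̄) T f`. -/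
def piS0 {n : ℕ} (f : Sph n → Cl n) (w : Sph n) : Cl n :=
  diracSBar (cauchyT f) w + conj (w : Ambient n) * cauchyT f w

/-- The first singular kernel `(1 - n - w̄²) / ‖w - v‖ⁿ`. -/
def kernelA {n : ℕ} (w v : Ambient n) : Cl n :=
  (‖w - v‖ ^ n)⁻¹ • (algebraMap ℝ (Cl n) (1 - n) - conj w ^ 2)

/-- The second singular kernel
`(v̄ - ⟨w, v⟩ w̄) / ‖w - v‖^{n+1} · (conjugate of (w - v)) / ‖w - v‖`. -/
def kernelB {n : ℕ} (w v : Ambient n) : Cl n :=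
  ((‖w - v‖ ^ (n + 1))⁻¹ • (conj v - inner ℝ w v • conj w)) * (‖w - v‖⁻¹ • conj (w - v))

/-- `𝕊ⁿ` without the closed ball of radius `ε` around `w`. -/
def outside {n : ℕ} (w : Sph n) (ε : ℝ) : Set (Sph n) :=
  {v | ε < ‖(w : Ambient n) - (v : Ambient n)‖}

end SphericalPi

end

noncomputable section

namespace SphericalPi

open MeasureTheory Set Metric Filter
open scoped ENNReal Pointwise

/-! ### Polar coordinates for nonnegative functions -/

section Polar

variable {E : Type*} [NormedAddCommGroup E] [NormedSpace ℝ E] [MeasurableSpace E] [BorelSpace E]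
  [FiniteDimensional ℝ E]

/-! Part (1) is algebra. On paravectors `x D̄ = E + Γ̄₀` (`paravector_mul_diracBar`), and `w̄ w = 1`
on the sphere, so `w̄ Γ̄₀ = D̄ - w̄ E`. This combination sees only tangential derivatives, hence
takes the same value on the radial extension of `T f` and on any other differentiable extension
(`piS0_eq`).

In part (2) the difficulty is that differentiating the Cauchy kernel produces a singularity of order
`‖w - v‖^{-n}`, which is not integrable on an `n`-dimensional sphere. Write `f = (f - f(w)) + f(w)`
and put `S = 1 - n - w̄²`.

The density `f - f(w)` is `O(‖w - v‖)` because `f` is `C¹` (`exists_lipschitz_at`). The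
differentiated kernel times it is `O(‖w - v‖^{1-n})`, which is integrable, and differentiation under
the integral is legitimate along the sphere (`hasFDerivWithinAt_cauchyIntegral`). The tangential
part of `D̄` turns the Cauchy kernel into exactly `A + n B`, the kernel of the principal value
(`diracSymbol_dKernel_comp_tangentProj`).

For the constant density, symmetry gives `T 1 (w) = (2/n) w̄` (`integral_cauchyKernel`), whose
tangential `D̄` is `(2/n) S`. The truncated integral of `A + n B` is also explicit: the leading
singularities cancel on averaging over the sphere, leaving `S` times a quarter of the truncated
integral of `‖w - v‖^{2-n}` (`integral_outside_kernelSum`), with limit `(ω_n/n) S`. So the principal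
value accounts for `1/n` out of `2/n`, and the other `1/n` is the free term `S f(w) / n`. Both
constants come from the one integral `∫ ‖w - v‖^{2-n} dv = 4 ω_n / n` (`integral_norm_sub_sq_div`).
-/

theorem lintegral_volumeIoiPow (k : ℕ) {F : ℝ → ℝ≥0∞} (hF : Measurable F) :
    ∫⁻ r : Ioi (0 : ℝ), F r ∂(Measure.volumeIoiPow k)
      = ∫⁻ r in Ioi (0 : ℝ), ENNReal.ofReal (r ^ k) * F r := by
  rw [Measure.volumeIoiPow, lintegral_withDensity_eq_lintegral_mul _ (by fun_prop) (by fun_prop)]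
  exact lintegral_subtype_comap measurableSet_Ioi (fun r : ℝ => ENNReal.ofReal (r ^ k) * F r)

theorem lintegral_eq_lintegral_sphere [Nontrivial E] (μ : Measure E) [μ.IsAddHaarMeasure]
    {F : E → ℝ≥0∞} (hF : Measurable F) :
    ∫⁻ x, F x ∂μ = ∫⁻ v : sphere (0 : E) 1, (∫⁻ r in Ioi (0 : ℝ),
      ENNReal.ofReal (r ^ (Module.finrank ℝ E - 1)) * F (r • (v : E))) ∂μ.toSphere := by
  have h := μ.measurePreserving_homeomorphUnitSphereProd.lintegral_comp_emb
    (Homeomorph.measurableEmbedding _) (fun p => F ((p.2 : ℝ) • (p.1 : E)))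
  have h' : ∀ x : ({(0)}ᶜ : Set E), F ((((homeomorphUnitSphereProd E) x).2 : ℝ) •
      (((homeomorphUnitSphereProd E) x).1 : E)) = F x := fun x => by
    have hx : ‖(x : E)‖ ≠ 0 := norm_ne_zero_iff.mpr x.2
    simp [smul_smul, hx]
  simp only [h'] at h
  rw [lintegral_subtype_comap (measurableSet_singleton _).compl F,
    restrict_compl_singleton] at h
  rw [h, lintegral_prod _ (by fun_prop)]
  refine lintegral_congr fun v => ?_
  exact lintegral_volumeIoiPow _ (F := fun r => F (r • (v : E))) (by fun_prop)

theorem lintegral_fun_norm [Nontrivial E] (μ : Measure E) [μ.IsAddHaarMeasure]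
    {F : ℝ → ℝ≥0∞} (hF : Measurable F) :
    ∫⁻ x, F ‖x‖ ∂μ = μ.toSphere univ *
      ∫⁻ r in Ioi (0 : ℝ), ENNReal.ofReal (r ^ (Module.finrank ℝ E - 1)) * F r := by
  rw [lintegral_eq_lintegral_sphere μ (by fun_prop)]
  rw [mul_comm, ← lintegral_const]
  refine lintegral_congr fun v => setLIntegral_congr_fun measurableSet_Ioi fun r hr => ?_
  have hr' : (0 : ℝ) < r := hr
  simp [norm_smul, abs_of_pos hr']

end Polar

/-! ### Invariance of the surface measure under linear isometries -/

section Isometry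

variable {E : Type*} [NormedAddCommGroup E] [InnerProductSpace ℝ E] [MeasurableSpace E]
  [BorelSpace E] [FiniteDimensional ℝ E]

/-- The homeomorphism of the unit sphere induced by a linear isometry. -/
def sphereIso (A : E ≃ₗᵢ[ℝ] E) : sphere (0 : E) 1 ≃ₜ sphere (0 : E) 1 where
  toFun v := ⟨A v, by simp⟩
  invFun v := ⟨A.symm v, by simp⟩
  left_inv v := by simp
  right_inv v := by simp
  continuous_toFun := by fun_prop
  continuous_invFun := by fun_prop

omit [MeasurableSpace E] [BorelSpace E] [FiniteDimensional ℝ E] in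
@[simp] theorem coe_sphereIso (A : E ≃ₗᵢ[ℝ] E) (v : sphere (0 : E) 1) :
    (sphereIso A v : E) = A v := rfl

/-- The surface measure of `s` is the dimension times the volume of the cone `(0,1) • s`; a linear
isometry carries cones to cones and preserves volume. -/
theorem measurePreserving_sphereIso (A : E ≃ₗᵢ[ℝ] E) :
    MeasurePreserving (sphereIso A) (volume : Measure E).toSphere
      (volume : Measure E).toSphere := by
  refine ⟨(sphereIso A).measurable, Measure.ext fun s hs => ?_⟩
  have hs' := (sphereIso A).measurable hs
  rw [Measure.map_apply (sphereIso A).measurable hs, Measure.toSphere_apply' _ hs,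
    Measure.toSphere_apply' _ hs']
  congr 1
  refine Eq.trans ?_ (A.measurePreserving.measure_preimage_equiv (f := A.toMeasurableEquiv) _)
  congr 1
  ext x
  simp only [Set.mem_smul, Set.mem_image, mem_preimage]
  constructor
  · rintro ⟨r, hr, _, ⟨v, hv, rfl⟩, rfl⟩
    exact ⟨r, hr, _, ⟨_, hv, rfl⟩, (map_smul A r (v : E)).symm⟩
  · rintro ⟨r, hr, _, ⟨v, hv, rfl⟩, h⟩
    refine ⟨r, hr, _, ⟨(sphereIso A).symm v, by simpa using hv, rfl⟩, ?_⟩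
    apply A.injective
    change r • (v : E) = A x at h
    rw [← h, map_smul]
    congr 1
    exact A.apply_symm_apply v

end Isometry

/-! ### Zonal integrals on the sphere -/

theorem toSphere_univ_eq_omega {n : ℕ} (hn : 1 ≤ n) :
    (volume : Measure (EuclideanSpace ℝ (Fin n))).toSphere univ = ENNReal.ofReal (omega n) := by
  have : Nonempty (Fin n) := ⟨⟨0, hn⟩⟩
  have hn' : (0 : ℝ) < n := by exact_mod_cast hn
  rw [Measure.toSphere_apply_univ, EuclideanSpace.volume_ball, omega]
  simp only [Fintype.card_fin, finrank_euclideanSpace, ENNReal.ofReal_one, one_pow, one_mul]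
  rw [← ENNReal.ofReal_natCast, ← ENNReal.ofReal_mul (by positivity)]
  congr 1
  rw [Real.Gamma_add_one (by positivity), Real.sqrt_eq_rpow, ← Real.rpow_natCast,
    ← Real.rpow_mul Real.pi_pos.le]
  have := (Real.Gamma_pos_of_pos (s := (n : ℝ) / 2) (by positivity)).ne'
  field_simp

theorem omega_pos {n : ℕ} (hn : 1 ≤ n) : 0 < omega n := by
  have hn' : (0 : ℝ) < n := by exact_mod_cast hn
  have := Real.Gamma_pos_of_pos (s := (n : ℝ) / 2) (by positivity)
  rw [omega]
  positivity

/-- Cylindrical coordinates: split off `x₀` and use polar coordinates in the remaining `ℝⁿ`, which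
is where `ω_n` enters. -/
theorem lintegral_ambient (n : ℕ) (hn : 1 ≤ n) {F : ℝ → ℝ → ℝ≥0∞}
    (hF : Measurable (Function.uncurry F)) :
    ∫⁻ x : Ambient n, F (x 0) (√(∑ j : Fin n, x j.succ ^ 2)) =
      ENNReal.ofReal (omega n) * ∫⁻ t : ℝ, ∫⁻ ρ in Ioi (0 : ℝ),
        ENNReal.ofReal (ρ ^ (n - 1)) * F t ρ := by
  have : Nonempty (Fin n) := ⟨⟨0, hn⟩⟩
  have hF' : ∀ t, Measurable (F t) := fun t => hF.comp measurable_prodMk_left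
  rw [← (PiLp.volume_preserving_toLp (Fin (n + 1))).lintegral_comp
    (f := fun x : Ambient n => F (x 0) (√(∑ j : Fin n, x j.succ ^ 2)))
    (hF.comp (by fun_prop : Measurable fun x : Ambient n =>
      (x 0, √(∑ j : Fin n, x j.succ ^ 2))))]
  rw [← ((volume_preserving_piFinSuccAbove (fun _ : Fin (n + 1) => ℝ) 0).symm
    (MeasurableEquiv.piFinSuccAbove (fun _ : Fin (n + 1) => ℝ) 0)).lintegral_comp_emb
    (MeasurableEquiv.measurableEmbedding _)]
  simp only [MeasurableEquiv.piFinSuccAbove_symm_apply, Fin.insertNthEquiv_zero,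
    Fin.consEquiv_apply, Fin.cons_zero, Fin.cons_succ]
  rw [Measure.volume_eq_prod, lintegral_prod _ (by
    exact (hF.comp (by fun_prop : Measurable fun x : ℝ × (Fin n → ℝ) =>
      (x.1, √(∑ j : Fin n, x.2 j ^ 2)))).aemeasurable)]
  rw [← lintegral_const_mul' _ _ ENNReal.ofReal_ne_top]
  refine lintegral_congr fun t => ?_
  have h := lintegral_fun_norm (E := EuclideanSpace ℝ (Fin n)) volume (hF' t)
  rw [toSphere_univ_eq_omega hn, finrank_euclideanSpace, Fintype.card_fin] at h
  rw [← h, ← (PiLp.volume_preserving_toLp (Fin n)).lintegral_comp (by fun_prop)]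
  refine lintegral_congr fun y => ?_
  simp [EuclideanSpace.norm_eq]

/-- The integral of `g(x₀ / ‖x‖)` over the unit ball of `ℝ^{n+1}` is computed twice: in spherical
coordinates, and in cylindrical coordinates `(t, ρ)` followed by polar coordinates in that
half-plane. Both contain the radial factor `c = ∫₀¹ rⁿ dr`, which cancels. -/
theorem lintegral_zonal_single {n : ℕ} (hn : 1 ≤ n) {g : ℝ → ℝ≥0∞} (hg : Measurable g) :
    ∫⁻ v : Sph n, g ((v : Ambient n) 0) ∂(surface n) =
      ENNReal.ofReal (omega n) * ∫⁻ θ in Ioo 0 Real.pi,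
        ENNReal.ofReal (Real.sin θ ^ (n - 1)) * g (Real.cos θ) := by
  -- The cutoff to the unit ball only serves to make the common radial factor finite and nonzero.
  set W : ℝ → ℝ≥0∞ := (Iio 1).indicator 1 with hW
  have hWm : Measurable W := measurable_one.indicator measurableSet_Iio
  set c : ℝ≥0∞ := ∫⁻ r in Ioi (0 : ℝ), ENNReal.ofReal (r ^ n) * W r with hc
  have hc' : c = ENNReal.ofReal (1 / (n + 1)) := by
    have h := Measure.volumeIoiPow_apply_Iio n ⟨1, mem_Ioi.mpr one_pos⟩
    rw [← lintegral_indicator_one measurableSet_Iio] at h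
    rw [hc, ← lintegral_volumeIoiPow n hWm]
    simp only [one_pow] at h
    exact h
  have hc0 : c ≠ 0 := by
    rw [hc']; exact (ENNReal.ofReal_pos.mpr (by positivity)).ne'
  have hct : c ≠ ⊤ := hc' ▸ ENNReal.ofReal_ne_top
  have h1 : ∫⁻ x : Ambient n, g (x 0 / ‖x‖) * W ‖x‖
      = (∫⁻ v : Sph n, g ((v : Ambient n) 0) ∂(surface n)) * c := by
    rw [lintegral_eq_lintegral_sphere volume (by fun_prop), ← lintegral_mul_const' _ _ hct]
    refine lintegral_congr fun v => ?_
    rw [hc, ← lintegral_const_mul _ (by fun_prop)]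
    refine setLIntegral_congr_fun measurableSet_Ioi fun r hr => ?_
    have hr' : (0 : ℝ) < r := hr
    simp only [finrank_euclideanSpace, Fintype.card_fin, Nat.add_sub_cancel, norm_smul,
      PiLp.smul_apply, smul_eq_mul, norm_eq_of_mem_sphere, Real.norm_eq_abs, abs_of_pos hr',
      mul_one, mul_div_cancel_left₀ _ hr'.ne']
    ring
  have h2 := lintegral_ambient n hn (F := fun t ρ => g (t / √(t ^ 2 + ρ ^ 2)) * W (√(t ^ 2 + ρ ^ 2)))
    (by simp only [Function.uncurry_def]; fun_prop)
  have h3 : ∀ x : Ambient n, √(x 0 ^ 2 + √(∑ j : Fin n, x j.succ ^ 2) ^ 2) = ‖x‖ := fun x => by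
    rw [Real.sq_sqrt (Finset.sum_nonneg fun _ _ => sq_nonneg _), EuclideanSpace.norm_eq,
      Fin.sum_univ_succ]
    simp
  simp only [h3] at h2
  rw [h1] at h2
  set f : ℝ × ℝ → ℝ≥0∞ := fun p => (Ioi (0 : ℝ)).indicator (fun ρ => ENNReal.ofReal (ρ ^ (n - 1)) *
    (g (p.1 / √(p.1 ^ 2 + ρ ^ 2)) * W (√(p.1 ^ 2 + ρ ^ 2)))) p.2 with hf
  have hfm : Measurable f := by
    have : f = (univ ×ˢ Ioi (0 : ℝ)).indicator (fun p : ℝ × ℝ => ENNReal.ofReal (p.2 ^ (n - 1)) *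
        (g (p.1 / √(p.1 ^ 2 + p.2 ^ 2)) * W (√(p.1 ^ 2 + p.2 ^ 2)))) := by
      ext p
      simp [hf, indicator]
    rw [this]
    exact Measurable.indicator (by fun_prop) (MeasurableSet.univ.prod measurableSet_Ioi)
  have h4 : ∫⁻ t : ℝ, ∫⁻ ρ in Ioi (0 : ℝ), ENNReal.ofReal (ρ ^ (n - 1)) *
      (g (t / √(t ^ 2 + ρ ^ 2)) * W (√(t ^ 2 + ρ ^ 2))) = ∫⁻ p, f p := by
    rw [Measure.volume_eq_prod, lintegral_prod _ hfm.aemeasurable]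
    refine lintegral_congr fun t => ?_
    rw [← lintegral_indicator measurableSet_Ioi]
  have h5 : ∫⁻ p, f p = c * ∫⁻ θ in Ioo 0 Real.pi,
      ENNReal.ofReal (Real.sin θ ^ (n - 1)) * g (Real.cos θ) := by
    have hsub : Ioo 0 Real.pi ⊆ Ioo (-Real.pi) Real.pi :=
      Ioo_subset_Ioo_left (by linarith [Real.pi_pos])
    have h6 : ∫⁻ θ in Ioo 0 Real.pi, ENNReal.ofReal (Real.sin θ ^ (n - 1)) * g (Real.cos θ)
        = ∫⁻ θ in Ioo (-Real.pi) Real.pi, (Ioo 0 Real.pi).indicator (fun θ =>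
          ENNReal.ofReal (Real.sin θ ^ (n - 1)) * g (Real.cos θ)) θ := by
      rw [setLIntegral_indicator measurableSet_Ioo, inter_eq_left.mpr hsub]
    rw [← lintegral_comp_polarCoord_symm, h6, hc, ← lintegral_prod_mul
      (by fun_prop) (Measurable.aemeasurable (Measurable.indicator (by fun_prop) measurableSet_Ioo)),
      Measure.prod_restrict, ← Measure.volume_eq_prod]
    refine setLIntegral_congr_fun (measurableSet_Ioi.prod measurableSet_Ioo) ?_
    rintro ⟨r, θ⟩ ⟨hr, hθ⟩
    have hr' : (0 : ℝ) < r := hr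
    have hq : √((r * Real.cos θ) ^ 2 + (r * Real.sin θ) ^ 2) = r := by
      rw [show (r * Real.cos θ) ^ 2 + (r * Real.sin θ) ^ 2
        = r ^ 2 * (Real.sin θ ^ 2 + Real.cos θ ^ 2) by ring, Real.sin_sq_add_cos_sq, mul_one,
        Real.sqrt_sq hr'.le]
    simp only [hf, polarCoord_symm_apply, smul_eq_mul]
    by_cases hpos : 0 < θ
    · have hs : 0 < Real.sin θ := Real.sin_pos_of_pos_of_lt_pi hpos hθ.2
      rw [indicator_of_mem (mem_Ioi.mpr (mul_pos hr' hs)),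
        indicator_of_mem (show θ ∈ Ioo 0 Real.pi from ⟨hpos, hθ.2⟩), hq,
        mul_div_cancel_left₀ _ hr'.ne', mul_pow, ENNReal.ofReal_mul (by positivity)]
      -- The planar Jacobian `r` times the factor `r^{n-1}` from `ρ^{n-1}` restores the radial
      -- density `rⁿ`.
      have : ENNReal.ofReal (r ^ n) = ENNReal.ofReal r * ENNReal.ofReal (r ^ (n - 1)) := by
        rw [← ENNReal.ofReal_mul hr'.le, ← pow_succ', Nat.sub_add_cancel hn]
      rw [this]
      ring
    -- Angles outside `(0, π)` give `ρ ≤ 0`, where the integrand is cut off.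
    · have hs : Real.sin θ ≤ 0 := Real.sin_nonpos_of_nonpos_of_neg_pi_le (not_lt.mp hpos) hθ.1.le
      rw [indicator_of_notMem (by
        simpa using mul_nonpos_of_nonneg_of_nonpos hr'.le hs), indicator_of_notMem (by simp [hpos])]
      simp
  rw [h4, h5, mul_left_comm, mul_comm] at h2
  exact (ENNReal.mul_right_inj hc0 hct).mp h2

/-- Any two points of the sphere are exchanged by a reflection. -/
theorem exists_isometry_map {n : ℕ} (w u : Sph n) :
    ∃ A : Ambient n ≃ₗᵢ[ℝ] Ambient n, A w = u :=
  ⟨_, Submodule.reflection_sub (by simp)⟩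

theorem lintegral_zonal {n : ℕ} (hn : 1 ≤ n) (w : Sph n) {g : ℝ → ℝ≥0∞} (hg : Measurable g) :
    ∫⁻ v : Sph n, g (inner ℝ (w : Ambient n) v) ∂(surface n) =
      ENNReal.ofReal (omega n) * ∫⁻ θ in Ioo 0 Real.pi,
        ENNReal.ofReal (Real.sin θ ^ (n - 1)) * g (Real.cos θ) := by
  obtain ⟨A, hA⟩ := exists_isometry_map w ⟨EuclideanSpace.single 0 1, by simp⟩
  rw [← lintegral_zonal_single hn hg]
  have h := (measurePreserving_sphereIso A).lintegral_comp
    (f := fun v => g ((v : Ambient n) 0)) (by fun_prop)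
  rw [surface, ← h]
  refine lintegral_congr fun v => ?_
  rw [coe_sphereIso, ← A.inner_map_map, hA, EuclideanSpace.inner_single_left]
  simp

theorem norm_sub_sq_sphere {n : ℕ} (w v : Sph n) :
    ‖(w : Ambient n) - v‖ ^ 2 = 2 - 2 * inner ℝ (w : Ambient n) v := by
  rw [norm_sub_sq_real, norm_eq_of_mem_sphere, norm_eq_of_mem_sphere]
  ring

theorem lintegral_fun_norm_sub {n : ℕ} (hn : 1 ≤ n) (w : Sph n) {g : ℝ → ℝ≥0∞}
    (hg : Measurable g) :
    ∫⁻ v : Sph n, g ‖(w : Ambient n) - v‖ ∂(surface n) =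
      ENNReal.ofReal (omega n) * ∫⁻ θ in Ioo 0 Real.pi,
        ENNReal.ofReal (Real.sin θ ^ (n - 1)) * g (2 * Real.sin (θ / 2)) := by
  have h := lintegral_zonal hn w (g := fun s => g √(2 - 2 * s)) (by fun_prop)
  simp only [← norm_sub_sq_sphere, Real.sqrt_sq (norm_nonneg _)] at h
  rw [h]
  congr 1
  refine setLIntegral_congr_fun measurableSet_Ioo fun θ hθ => ?_
  have hs : 0 < Real.sin (θ / 2) :=
    Real.sin_pos_of_pos_of_lt_pi (by linarith [hθ.1]) (by linarith [hθ.1, hθ.2])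
  have : 2 - 2 * Real.cos θ = (2 * Real.sin (θ / 2)) ^ 2 := by
    have h1 := Real.cos_two_mul (θ / 2)
    have h2 := Real.sin_sq_add_cos_sq (θ / 2)
    rw [mul_div_cancel₀ _ two_ne_zero] at h1
    linarith
  rw [this, Real.sqrt_sq (by positivity)]

/-! ### Weakly singular integrals -/

/-- By `sin θ = 2 sin(θ/2) cos(θ/2)`, the density of the surface measure cancels the singularity
`r^{1-n}` at chord length `r = 2 sin(θ/2)`; what remains is bounded. -/
theorem sin_pow_mul_inv_pow {n : ℕ} (hn : 1 ≤ n) {θ : ℝ} (hθ : θ ∈ Ioo 0 Real.pi) :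
    Real.sin θ ^ (n - 1) * ((2 * Real.sin (θ / 2)) * ((2 * Real.sin (θ / 2)) ^ n)⁻¹) =
      Real.cos (θ / 2) ^ (n - 1) := by
  have hs : 0 < Real.sin (θ / 2) :=
    Real.sin_pos_of_pos_of_lt_pi (by linarith [hθ.1]) (by linarith [hθ.1, hθ.2])
  have h1 := Real.sin_two_mul (θ / 2)
  rw [mul_div_cancel₀ _ two_ne_zero] at h1
  obtain ⟨k, rfl⟩ := Nat.exists_eq_add_of_le' hn
  rw [h1, Nat.add_sub_cancel, mul_pow, mul_pow, pow_succ, mul_pow]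
  field_simp

/-- The radial bound `r^{1-n}` for the kernel of the Cauchy transform, with value `0` at `0`. -/
def weakSingularity (n : ℕ) (r : ℝ) : ℝ := r * (r ^ n)⁻¹

theorem weakSingularity_nonneg {n : ℕ} {r : ℝ} (hr : 0 ≤ r) : 0 ≤ weakSingularity n r := by
  rw [weakSingularity]; positivity

@[fun_prop]
theorem measurable_weakSingularity (n : ℕ) : Measurable (weakSingularity n) := by
  unfold weakSingularity; fun_prop

instance (n : ℕ) : IsFiniteMeasure (surface n) := by unfold surface; infer_instance

theorem integrable_weakSingularity {n : ℕ} (hn : 1 ≤ n) (w : Sph n) :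
    Integrable (fun v : Sph n => weakSingularity n ‖(w : Ambient n) - v‖) (surface n) := by
  refine ⟨(by fun_prop : Measurable _).aestronglyMeasurable, ?_⟩
  rw [hasFiniteIntegral_iff_ofReal (ae_of_all _ fun v => weakSingularity_nonneg (norm_nonneg _)),
    lintegral_fun_norm_sub hn w (g := fun r => ENNReal.ofReal (weakSingularity n r)) (by fun_prop)]
  refine ENNReal.mul_lt_top ENNReal.ofReal_lt_top ?_
  calc _ ≤ ∫⁻ _ in Ioo 0 Real.pi, 1 := setLIntegral_mono' measurableSet_Ioo fun θ hθ => by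
        rw [← ENNReal.ofReal_mul (pow_nonneg (Real.sin_nonneg_of_nonneg_of_le_pi hθ.1.le hθ.2.le) _),
          weakSingularity, sin_pow_mul_inv_pow hn hθ, ← ENNReal.ofReal_one]
        exact ENNReal.ofReal_le_ofReal (pow_le_one₀ (Real.cos_nonneg_of_mem_Icc
          ⟨by linarith [hθ.1, Real.pi_pos], by linarith [hθ.2]⟩) (Real.cos_le_one _))
    _ < ⊤ := by simp

theorem integral_cos_half_pow {n : ℕ} (hn : 1 ≤ n) :
    ∫ θ in (0 : ℝ)..Real.pi, 2 * Real.sin (θ / 2) * Real.cos (θ / 2) ^ (n - 1) = 4 / n := by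
  have hn' : (n : ℝ) ≠ 0 := by exact_mod_cast (by omega : n ≠ 0)
  have hd : ∀ θ ∈ uIcc (0 : ℝ) Real.pi, HasDerivAt (fun θ => -(4 / n : ℝ) * Real.cos (θ / 2) ^ n)
      (2 * Real.sin (θ / 2) * Real.cos (θ / 2) ^ (n - 1)) θ := fun θ _ => by
    have h1 : HasDerivAt (fun θ : ℝ => Real.cos (θ / 2)) (-Real.sin (θ / 2) * (1 / 2)) θ :=
      ((hasDerivAt_id θ).div_const 2).cos
    refine ((h1.pow n).const_mul (-(4 / n : ℝ))).congr_deriv ?_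
    field_simp
    ring
  rw [intervalIntegral.integral_eq_sub_of_hasDerivAt hd
    (Continuous.intervalIntegrable (by fun_prop) _ _)]
  simp [Real.cos_pi_div_two, zero_pow (by omega : n ≠ 0)]

theorem integral_norm_sub_sq_div {n : ℕ} (hn : 1 ≤ n) (w : Sph n) :
    ∫ v : Sph n, ‖(w : Ambient n) - v‖ ^ 2 * (‖(w : Ambient n) - v‖ ^ n)⁻¹ ∂(surface n)
      = omega n * (4 / n) := by
  rw [integral_eq_lintegral_of_nonneg_ae (ae_of_all _ fun v => by positivity)
    (by fun_prop : Measurable _).aestronglyMeasurable,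
    lintegral_fun_norm_sub hn w (g := fun r => ENNReal.ofReal (r ^ 2 * (r ^ n)⁻¹)) (by fun_prop),
    ENNReal.toReal_mul, ENNReal.toReal_ofReal (omega_pos hn).le, ← integral_cos_half_pow hn,
    intervalIntegral.integral_of_le Real.pi_pos.le, ← restrict_Ioo_eq_restrict_Ioc,
    integral_eq_lintegral_of_nonneg_ae]
  · congr 2
    refine setLIntegral_congr_fun measurableSet_Ioo fun θ hθ => ?_
    rw [← ENNReal.ofReal_mul (pow_nonneg (Real.sin_nonneg_of_nonneg_of_le_pi hθ.1.le hθ.2.le) _),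
      ← sin_pow_mul_inv_pow hn hθ]
    congr 1
    ring
  · filter_upwards [ae_restrict_mem measurableSet_Ioo] with θ hθ
    have := Real.sin_nonneg_of_nonneg_of_le_pi (x := θ / 2) (by linarith [hθ.1])
      (by linarith [hθ.1, hθ.2])
    have := Real.cos_nonneg_of_mem_Icc (x := θ / 2)
      ⟨by linarith [hθ.1, Real.pi_pos], by linarith [hθ.2]⟩
    simp only [Pi.zero_apply]
    positivity
  · exact Continuous.aestronglyMeasurable (by fun_prop)

theorem integrable_norm_sub_sq_div {n : ℕ} (hn : 1 ≤ n) (w : Sph n) :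
    Integrable (fun v : Sph n => ‖(w : Ambient n) - v‖ ^ 2 * (‖(w : Ambient n) - v‖ ^ n)⁻¹)
      (surface n) := by
  -- The Bochner integral of a non-integrable function is zero, so the explicit nonzero value
  -- already gives integrability.
  refine Integrable.of_integral_ne_zero ?_
  have : (0 : ℝ) < n := by exact_mod_cast hn
  have := omega_pos hn
  rw [integral_norm_sub_sq_div hn]
  positivity

theorem integral_comp_isometry {n : ℕ} {F : Type*} [NormedAddCommGroup F] [NormedSpace ℝ F]
    (A : Ambient n ≃ₗᵢ[ℝ] Ambient n) (φ : Sph n → F) :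
    ∫ v, φ (sphereIso A v) ∂(surface n) = ∫ v, φ v ∂(surface n) :=
  (measurePreserving_sphereIso A).integral_comp (sphereIso A).measurableEmbedding φ

/-- A reflection exchanges the two centres. It makes cap integrals independent of the centre, which
gives uniformity when the base point moves. -/
theorem integral_fun_norm_sub_congr {n : ℕ} (w u : Sph n) (φ : ℝ → ℝ) :
    ∫ v : Sph n, φ ‖(w : Ambient n) - v‖ ∂(surface n)
      = ∫ v : Sph n, φ ‖(u : Ambient n) - v‖ ∂(surface n) := by
  obtain ⟨A, hA⟩ := exists_isometry_map w u
  rw [← integral_comp_isometry A fun v => φ ‖(u : Ambient n) - v‖]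
  refine integral_congr_ae (ae_of_all _ fun v => ?_)
  simp only [coe_sphereIso]
  rw [← hA, ← map_sub, A.norm_map]

theorem norm_indicator_weakSingularity_le {n : ℕ} (s : Set ℝ) {r : ℝ} (hr : 0 ≤ r) :
    ‖s.indicator (weakSingularity n) r‖ ≤ weakSingularity n r := by
  refine (norm_indicator_le_norm_self _ _).trans_eq (Real.norm_of_nonneg ?_)
  exact weakSingularity_nonneg hr

/-- The integral of the weak singularity over a cap of radius `η`. -/
def capIntegral {n : ℕ} (w : Sph n) (η : ℝ) : ℝ :=
  ∫ v : Sph n, (Iic η).indicator (weakSingularity n) ‖(w : Ambient n) - v‖ ∂(surface n)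

theorem integrable_indicator_weakSingularity {n : ℕ} (hn : 1 ≤ n) (w : Sph n) (η : ℝ) :
    Integrable (fun v : Sph n =>
      (Iic η).indicator (weakSingularity n) ‖(w : Ambient n) - v‖) (surface n) := by
  have hm : Measurable ((Iic η).indicator (weakSingularity n)) :=
    (measurable_weakSingularity n).indicator measurableSet_Iic
  refine (integrable_weakSingularity hn w).mono'
    (by fun_prop : Measurable _).aestronglyMeasurable (ae_of_all _ fun v =>
      norm_indicator_weakSingularity_le _ (norm_nonneg _))

theorem tendsto_capIntegral {n : ℕ} (hn : 1 ≤ n) (w : Sph n) :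
    Filter.Tendsto (capIntegral w) (𝓝 0) (𝓝 0) := by
  suffices H : Filter.Tendsto (capIntegral w) (𝓝 0) (𝓝 (∫ _ : Sph n, (0 : ℝ) ∂(surface n))) by
    simpa using H
  refine tendsto_integral_filter_of_dominated_convergence
    (fun v : Sph n => weakSingularity n ‖(w : Ambient n) - v‖)
    (Filter.Eventually.of_forall fun η =>
      (integrable_indicator_weakSingularity hn w η).aestronglyMeasurable)
    (Filter.Eventually.of_forall fun η => ae_of_all _ fun v =>
      norm_indicator_weakSingularity_le _ (norm_nonneg _))
    (integrable_weakSingularity hn w) (ae_of_all _ fun v => ?_)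
  · refine tendsto_const_nhds.congr' ?_
    rcases (norm_nonneg ((w : Ambient n) - v)).eq_or_lt with h | h
    -- At the pole the weak singularity takes the value `0`, even for `n = 1`, so no null set has to
    -- be removed.
    · exact Filter.Eventually.of_forall fun η => by
        rw [← h]; simp [indicator, weakSingularity]
    · filter_upwards [Iio_mem_nhds h] with η hη
      rw [indicator_of_notMem (by simpa using hη)]

/-! ### Paravector algebra and first-order operators -/

theorem cliffordForm_apply {n : ℕ} (a : Fin n → ℝ) : cliffordForm n a = -∑ j, a j ^ 2 := by
  simp [cliffordForm, QuadraticMap.weightedSumSquares_apply, pow_two]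

theorem e_mul_self {n : ℕ} (j : Fin n) : e n j * e n j = -1 := by
  rw [e, CliffordAlgebra.ι_sq_scalar, cliffordForm_apply]
  simp [Pi.single_apply]

theorem e_mul_e_swap {n : ℕ} {i j : Fin n} (h : i ≠ j) : e n i * e n j = -(e n j * e n i) := by
  have h1 := CliffordAlgebra.ι_mul_ι_add_swap (Q := cliffordForm n) (Pi.single i 1) (Pi.single j 1)
  have h2 : QuadraticMap.polar (cliffordForm n) (Pi.single i 1) (Pi.single j 1) = 0 := by
    simp only [QuadraticMap.polar, cliffordForm_apply, ← Finset.sum_neg_distrib,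
      ← Finset.sum_sub_distrib]
    refine Finset.sum_eq_zero fun k _ => ?_
    by_cases hk : k = i
    · subst hk; simp [h]
    · simp [hk]
  rw [h2, map_zero] at h1
  exact eq_neg_of_add_eq_zero_left h1

/-- Conjugation of paravectors, as a continuous linear map. -/
def conjL (n : ℕ) : Ambient n →L[ℝ] Cl n :=
  LinearMap.toContinuousLinearMap
    { toFun := conj
      map_add' := fun x y => by
        simp only [conj, ← map_add, paravector]
        congr 1
        simp only [PiLp.add_apply, map_add, add_smul, Finset.sum_add_distrib]
        abel
      map_smul' := fun c x => by
        simp only [conj, RingHom.id_apply, ← map_smul, paravector]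
        congr 1
        simp [Algebra.algebraMap_eq_smul_one, smul_add, smul_smul, Finset.smul_sum] }

@[simp] theorem conjL_apply {n : ℕ} (x : Ambient n) : conjL n x = conj x := rfl

theorem conj_eq {n : ℕ} (x : Ambient n) :
    conj x = algebraMap ℝ (Cl n) (x 0) - ∑ j : Fin n, x j.succ • e n j := by
  simp [conj, paravector, e, sub_eq_add_neg]

theorem conj_single_zero (n : ℕ) : conj (EuclideanSpace.single 0 1 : Ambient n) = 1 := by
  simp [conj_eq]

theorem conj_single_succ {n : ℕ} (j : Fin n) :
    conj (EuclideanSpace.single j.succ 1 : Ambient n) = - e n j := by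
  simp [conj_eq, PiLp.single_apply]

theorem sum_smul_e_sq {n : ℕ} (a : Fin n → ℝ) :
    (∑ j : Fin n, a j • e n j) * (∑ j : Fin n, a j • e n j) =
      algebraMap ℝ (Cl n) (-∑ j : Fin n, a j ^ 2) := by
  have h : ∑ j : Fin n, a j • e n j = CliffordAlgebra.ι (cliffordForm n) a := by
    simp only [e, ← map_smul, ← map_sum]
    congr 1
    ext k
    simp [Finset.sum_apply, Pi.single_apply]
  rw [h, CliffordAlgebra.ι_sq_scalar, cliffordForm_apply]

theorem norm_sq_ambient {n : ℕ} (x : Ambient n) : ‖x‖ ^ 2 = x 0 ^ 2 + ∑ j : Fin n, x j.succ ^ 2 := by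
  rw [EuclideanSpace.norm_sq_eq, Fin.sum_univ_succ]
  simp

theorem conj_mul_paravector {n : ℕ} (x : Ambient n) :
    conj x * paravector x = algebraMap ℝ (Cl n) (‖x‖ ^ 2) := by
  rw [norm_sq_ambient, conj_eq, paravector, sub_mul, mul_add, mul_add, sum_smul_e_sq,
    Algebra.commutes (x 0) (∑ j : Fin n, x j.succ • e n j), map_add, map_neg, pow_two (x 0),
    map_mul]
  abel

/-- The quadratic equation of `x̄`, from its trace `x̄ + x = 2 x₀` and norm `x̄ x = ‖x‖²`. -/
theorem conj_sq {n : ℕ} (x : Ambient n) :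
    conj x * conj x = (2 * x 0) • conj x - algebraMap ℝ (Cl n) (‖x‖ ^ 2) := by
  have h : conj x + paravector x = algebraMap ℝ (Cl n) (2 * x 0) := by
    rw [conj_eq, paravector, two_mul, map_add]; abel
  rw [← conj_mul_paravector, Algebra.smul_def, Algebra.commutes, ← h, mul_add,
    add_sub_cancel_right]

/-- The operator `∑ ē_i L(e_i)` attached to a linear map `L`; it is `D̄` for `L` the derivative. -/
def diracSymbol {n : ℕ} (L : Ambient n → Cl n) : Cl n :=
  ∑ i : Fin (n + 1), conj (EuclideanSpace.single i 1 : Ambient n) * L (EuclideanSpace.single i 1)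

theorem diracBar_eq_diracSymbol {n : ℕ} (F : Ambient n → Cl n) (x : Ambient n) :
    diracBar F x = diracSymbol (fderiv ℝ F x) := by
  simp [diracBar, diracSymbol, partialDeriv, Fin.sum_univ_succ, conj_single_zero,
    conj_single_succ, sub_eq_add_neg]

theorem sum_smul_single {n : ℕ} (x : Ambient n) :
    ∑ i : Fin (n + 1), x i • (EuclideanSpace.single i 1 : Ambient n) = x := by
  simpa using (EuclideanSpace.basisFun (Fin (n + 1)) ℝ).sum_repr x

theorem euler_eq {n : ℕ} (F : Ambient n → Cl n) (x : Ambient n) :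
    euler F x = fderiv ℝ F x x := by
  simp only [euler, partialDeriv, ← map_smul, ← map_sum, sum_smul_single]

/-- Diagonal terms use `e_i² = -1`; the terms `(i, j)` and `(j, i)` merge by anticommutation into
the rotation fields of `Γ̄₀`. -/
theorem sum_succ_mul_sum {n : ℕ} (x : Fin n → ℝ) (d : Fin n → Cl n) :
    (∑ i, x i • e n i) * ∑ j, e n j * d j =
      -∑ i, x i • d i + ∑ i : Fin n, ∑ j ∈ Finset.Ioi i,
        e n i * e n j * (x i • d j - x j • d i) := by
  have h1 : ∀ i : Fin n, ∑ j : Fin n, x i • (e n i * (e n j * d j)) = - x i • d i +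
      (∑ j ∈ Finset.Ioi i, x i • (e n i * (e n j * d j)) +
      ∑ j ∈ Finset.Iio i, x i • (e n i * (e n j * d j))) := fun i => by
    have hu : (Finset.univ : Finset (Fin n)) = insert i (Finset.Ioi i ∪ Finset.Iio i) := by
      ext j
      simp only [Finset.mem_univ, Finset.mem_insert, Finset.mem_union, Finset.mem_Ioi,
        Finset.mem_Iio, true_iff]
      omega
    rw [hu, Finset.sum_insert (by simp), Finset.sum_union]
    · rw [← mul_assoc, e_mul_self]; simp
    · rw [Finset.disjoint_left]
      intro j h2 h3
      simp only [Finset.mem_Ioi, Finset.mem_Iio] at h2 h3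
      omega
  have h2 : ∑ i : Fin n, ∑ j ∈ Finset.Iio i, x i • (e n i * (e n j * d j)) =
      ∑ i : Fin n, ∑ j ∈ Finset.Ioi i, x j • (e n j * (e n i * d i)) :=
    Finset.sum_comm' (by simp)
  rw [Finset.sum_mul_sum]
  simp only [smul_mul_assoc, h1, Finset.sum_add_distrib, h2]
  rw [← Finset.sum_add_distrib]
  simp only [neg_smul, Finset.sum_neg_distrib]
  congr 1
  refine Finset.sum_congr rfl fun i _ => ?_
  rw [← Finset.sum_add_distrib]
  refine Finset.sum_congr rfl fun j hj => ?_
  have hij : j ≠ i := (Finset.mem_Ioi.mp hj).ne'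
  rw [← mul_assoc (e n j), e_mul_e_swap hij, mul_sub, mul_smul_comm, mul_smul_comm, mul_assoc,
    neg_mul, smul_neg, sub_eq_add_neg, mul_assoc]

/-- Splits `D̄` into its radial part `E` and its spherical part `Γ̄₀`. -/
theorem paravector_mul_diracBar {n : ℕ} (F : Ambient n → Cl n) (x : Ambient n) :
    paravector x * diracBar F x = euler F x + gammaBar F x := by
  have h := sum_succ_mul_sum (fun j => x j.succ) (fun j => partialDeriv j.succ F x)
  rw [paravector, diracBar, add_mul, mul_sub, mul_sub, h, euler, Fin.sum_univ_succ, gammaBar,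
    ← Algebra.smul_def, ← Algebra.smul_def]
  simp only [mul_sub, Finset.sum_sub_distrib, mul_smul_comm, Finset.smul_sum, Finset.sum_mul,
    smul_mul_assoc]
  abel

theorem conj_mul_gammaBar {n : ℕ} (F : Ambient n → Cl n) (w : Sph n) :
    conj (w : Ambient n) * gammaBar F w = diracBar F w - conj (w : Ambient n) * euler F w := by
  have h := congrArg (conj (w : Ambient n) * ·) (paravector_mul_diracBar F (w : Ambient n))
  simp only [← mul_assoc, conj_mul_paravector, mul_add, norm_eq_of_mem_sphere, one_pow, map_one,
    one_mul] at h
  rw [h]; abel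

/-- Multiplication of the Clifford algebra as a continuous bilinear map. -/
def mulL (n : ℕ) : Cl n →L[ℝ] Cl n →L[ℝ] Cl n :=
  (LinearMap.mul ℝ (Cl n)).toContinuousBilinearMap

@[simp] theorem mulL_apply {n : ℕ} (a b : Cl n) : mulL n a b = a * b := rfl

theorem norm_mul_le_mulL {n : ℕ} (a b : Cl n) : ‖a * b‖ ≤ ‖mulL n‖ * ‖a‖ * ‖b‖ :=
  (mulL n).le_opNorm₂ a b

instance (n : ℕ) : ContinuousMul (Cl n) :=
  ⟨(mulL n).continuous₂⟩

@[fun_prop]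
theorem continuous_conj {n : ℕ} : Continuous (conj : Ambient n → Cl n) := (conjL n).continuous

theorem norm_conj_le {n : ℕ} (x : Ambient n) : ‖conj x‖ ≤ ‖conjL n‖ * ‖x‖ := (conjL n).le_opNorm x

theorem conj_sub {n : ℕ} (x y : Ambient n) : conj (x - y) = conj x - conj y := map_sub (conjL n) x y

theorem conj_smul {n : ℕ} (c : ℝ) (x : Ambient n) : conj (c • x) = c • conj x :=
  map_smul (conjL n) c x

theorem conj_neg {n : ℕ} (x : Ambient n) : conj (-x) = - conj x := map_neg (conjL n) x

theorem conj_sum {n : ℕ} {ι : Type*} (s : Finset ι) (x : ι → Ambient n) :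
    conj (∑ i ∈ s, x i) = ∑ i ∈ s, conj (x i) := map_sum (conjL n) x s

/-! ### Averaging over isometries that fix `w` -/

theorem integral_mul_right_clifford {n : ℕ} {α : Type*} [MeasurableSpace α] {μ : Measure α} {g : α → Cl n}
    (hg : Integrable g μ) (c : Cl n) : ∫ x, g x * c ∂μ = (∫ x, g x ∂μ) * c :=
  ((mulL n).flip c).integral_comp_comm hg

theorem integrable_smul_of_bounded {n : ℕ} {F : Type*} [NormedAddCommGroup F] [NormedSpace ℝ F]
    (w : Sph n) {φ : ℝ → ℝ} (hφ : Measurable φ) {C : ℝ}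
    (hC : ∀ r, |φ r| ≤ C) {g : Sph n → F} (hg : Continuous g) :
    Integrable (fun v : Sph n => φ ‖(w : Ambient n) - v‖ • g v) (surface n) := by
  obtain ⟨D, hD⟩ := isCompact_univ.exists_bound_of_continuousOn hg.continuousOn
  refine Integrable.of_bound (C := C * D) (AEStronglyMeasurable.smul
    (by fun_prop : Measurable _).aestronglyMeasurable hg.aestronglyMeasurable)
    (ae_of_all _ fun v => ?_)
  rw [norm_smul]
  exact mul_le_mul (hC _) (hD v (mem_univ _)) (norm_nonneg _) ((abs_nonneg _).trans (hC 0))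

/-- The component of `v` orthogonal to the unit vector `w`. -/
def perp {n : ℕ} (w v : Ambient n) : Ambient n := v - inner ℝ w v • w

/-- The symbol `1 - n - w̄²`, equal to `∑ τ̄_k²` for an orthonormal basis `(τ_k)` of the tangent
space at `w`. -/
def tangentSymbol {n : ℕ} (w : Ambient n) : Cl n := algebraMap ℝ (Cl n) (1 - n) - conj w ^ 2

/-- Summing `conj_sq` over the basis: the terms `2 (b_k)₀ b̄_k` add up to `2 ē₀ = 2`, and the norms
subtract `n + 1`. The value does not depend on the basis, so one containing `w` can be used. -/
theorem sum_conj_sq {n : ℕ} (b : OrthonormalBasis (Fin (n + 1)) ℝ (Ambient n)) :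
    ∑ k, conj (b k) * conj (b k) = algebraMap ℝ (Cl n) (1 - n) := by
  have h := b.sum_repr (EuclideanSpace.single 0 1 : Ambient n)
  have h1 := congrArg (fun x => (2 : ℝ) • conj x) h
  simp only [conj_sum, conj_smul, conj_single_zero, Finset.smul_sum, smul_smul,
    OrthonormalBasis.repr_apply_apply, EuclideanSpace.inner_single_right] at h1
  simp only [conj_sq, Finset.sum_sub_distrib]
  simp only [one_mul, conj_trivial] at h1
  rw [h1]
  simp only [OrthonormalBasis.norm_eq_one, one_pow, map_one, Finset.sum_const, Finset.card_univ,
    Fintype.card_fin, map_sub, map_natCast]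
  rw [nsmul_eq_mul, two_smul]
  push_cast
  rw [mul_one]
  abel

theorem exists_basis_zero_eq {n : ℕ} (w : Sph n) :
    ∃ b : OrthonormalBasis (Fin (n + 1)) ℝ (Ambient n), b 0 = w := by
  have h : Orthonormal ℝ (({0} : Set (Fin (n + 1))).domRestrict fun _ => (w : Ambient n)) := by
    refine ⟨fun _ => norm_eq_of_mem_sphere w, fun i j hij => absurd (Subsingleton.elim i j) hij⟩
  obtain ⟨b, hb⟩ := h.exists_orthonormalBasis_extension_of_card_eq (by simp)
  exact ⟨b, hb 0 rfl⟩

theorem integral_comp_isometry_fixing {n : ℕ} {F : Type*} [NormedAddCommGroup F] [NormedSpace ℝ F]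
    {w : Sph n} {A : Ambient n ≃ₗᵢ[ℝ] Ambient n} (hA : A w = w) (φ : ℝ → ℝ) (g : Ambient n → F) :
    ∫ v : Sph n, φ ‖(w : Ambient n) - v‖ • g (A v) ∂(surface n) =
      ∫ v : Sph n, φ ‖(w : Ambient n) - v‖ • g v ∂(surface n) := by
  rw [← integral_comp_isometry A fun v : Sph n => φ ‖(w : Ambient n) - v‖ • g v]
  refine integral_congr_ae (ae_of_all _ fun v => ?_)
  simp only [coe_sphereIso]
  rw [show (w : Ambient n) - A v = A (w - v) by rw [map_sub, hA], A.norm_map]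

/-- The reflection in `a^⊥` fixes `w` and `c` and reverses `a`, so the integrand is odd. -/
theorem integral_inner_mul_inner_eq_zero {n : ℕ} {w : Sph n} (φ : ℝ → ℝ) {a c : Ambient n}
    (haw : inner ℝ a (w : Ambient n) = 0) (hac : inner ℝ a c = 0) :
    ∫ v : Sph n, φ ‖(w : Ambient n) - v‖ • (inner ℝ a (v : Ambient n) * inner ℝ c v) ∂(surface n)
      = 0 := by
  set A := ((ℝ ∙ a)ᗮ).reflection with hA
  have hAw : A (w : Ambient n) = w :=
    Submodule.reflection_mem_subspace_eq_self (Submodule.mem_orthogonal_singleton_iff_inner_right.mpr haw)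
  have hAc : A c = c :=
    Submodule.reflection_mem_subspace_eq_self (Submodule.mem_orthogonal_singleton_iff_inner_right.mpr hac)
  have hAa : A a = -a := Submodule.reflection_orthogonalComplement_singleton_eq_neg a
  have h := integral_comp_isometry_fixing hAw φ (fun v => inner ℝ a v * inner ℝ c v)
  have h1 : ∀ v, inner ℝ a (A v) = - inner ℝ a v := fun v => by
    rw [← A.inner_map_map a v, hAa, inner_neg_left, neg_neg]
  have h2 : ∀ v, inner ℝ c (A v) = inner ℝ c v := fun v => by
    rw [← A.inner_map_map c v, hAc]
  simp only [h1, h2, neg_mul, smul_neg, integral_neg] at h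
  linarith

/-- The reflection exchanging `a` and `c` fixes `w`. -/
theorem integral_inner_sq_congr {n : ℕ} {w : Sph n} (φ : ℝ → ℝ) {a c : Ambient n}
    (haw : inner ℝ a (w : Ambient n) = 0) (hcw : inner ℝ c (w : Ambient n) = 0)
    (hac : ‖a‖ = ‖c‖) :
    ∫ v : Sph n, φ ‖(w : Ambient n) - v‖ • (inner ℝ a (v : Ambient n) * inner ℝ a v) ∂(surface n)
      = ∫ v : Sph n, φ ‖(w : Ambient n) - v‖ • (inner ℝ c (v : Ambient n) * inner ℝ c v)
        ∂(surface n) := by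
  set A := ((ℝ ∙ (a - c))ᗮ).reflection with hA
  have hAw : A (w : Ambient n) = w :=
    Submodule.reflection_mem_subspace_eq_self
      (Submodule.mem_orthogonal_singleton_iff_inner_right.mpr (by rw [inner_sub_left, haw, hcw, sub_zero]))
  have hAa : A a = c := Submodule.reflection_sub hac
  rw [← integral_comp_isometry_fixing hAw φ (fun v => inner ℝ c v * inner ℝ c v)]
  simp only [← hAa, A.inner_map_map]

theorem perp_eq_sum {n : ℕ} {w : Ambient n} {b : OrthonormalBasis (Fin (n + 1)) ℝ (Ambient n)}
    (hb : b 0 = w) (v : Ambient n) :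
    perp w v = ∑ k : Fin n, inner ℝ (b k.succ) v • b k.succ := by
  have h := b.sum_repr v
  rw [Fin.sum_univ_succ] at h
  simp only [OrthonormalBasis.repr_apply_apply, hb] at h
  rw [perp, sub_eq_iff_eq_add', h]

theorem norm_sub_mul_four_sub {n : ℕ} (w v : Sph n) :
    1 - inner ℝ (w : Ambient n) v ^ 2 =
      ‖(w : Ambient n) - v‖ ^ 2 * (1 - ‖(w : Ambient n) - v‖ ^ 2 / 4) := by
  rw [norm_sub_sq_sphere]; ring

/-- With a weight depending only on `‖w - v‖`, the second-moment matrix of the tangential part of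
`v` is a multiple of the identity. Its trace is the integral of `1 - ⟨w, v⟩²`, and the identity
matrix contributes `∑ τ̄_k² = 1 - n - w̄²`. -/
theorem integral_conj_perp_sq {n : ℕ} (hn : 1 ≤ n) (w : Sph n) {φ : ℝ → ℝ} (hφ : Measurable φ)
    {C : ℝ} (hC : ∀ r, |φ r| ≤ C) :
    ∫ v : Sph n, φ ‖(w : Ambient n) - v‖ •
        (conj (perp (w : Ambient n) v) * conj (perp (w : Ambient n) v)) ∂(surface n) =
      ((n : ℝ)⁻¹ * ∫ v : Sph n, φ ‖(w : Ambient n) - v‖ *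
        (1 - inner ℝ (w : Ambient n) v ^ 2) ∂(surface n)) • tangentSymbol (w : Ambient n) := by
  obtain ⟨b, hb⟩ := exists_basis_zero_eq w
  have hn' : (n : ℝ) ≠ 0 := by exact_mod_cast (by omega : n ≠ 0)
  set I : Fin n → Fin n → ℝ := fun j k => ∫ v : Sph n, φ ‖(w : Ambient n) - v‖ •
    (inner ℝ (b j.succ) (v : Ambient n) * inner ℝ (b k.succ) v) ∂(surface n) with hI
  have hbw : ∀ j : Fin n, inner ℝ (b j.succ) (w : Ambient n) = 0 := fun j => by
    rw [← hb]; exact b.orthonormal.2 (Fin.succ_ne_zero j)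
  have hint : ∀ j k : Fin n, Integrable (fun v : Sph n => φ ‖(w : Ambient n) - v‖ •
      (inner ℝ (b j.succ) (v : Ambient n) * inner ℝ (b k.succ) (v : Ambient n))) (surface n) :=
    fun j k => integrable_smul_of_bounded w hφ hC (by fun_prop)
  have hoff : ∀ j k, j ≠ k → I j k = 0 := fun j k hjk =>
    integral_inner_mul_inner_eq_zero φ (hbw j)
      (b.orthonormal.2 (fun h => hjk (Fin.succ_injective _ h)))
  set i0 : Fin n := ⟨0, hn⟩
  have hdiag : ∀ j, I j j = I i0 i0 := fun j =>
    integral_inner_sq_congr φ (hbw j) (hbw i0) (by simp)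
  have hsum : ∑ j, I j j = ∫ v : Sph n, φ ‖(w : Ambient n) - v‖ *
      (1 - inner ℝ (w : Ambient n) v ^ 2) ∂(surface n) := by
    rw [hI, ← integral_finsetSum _ fun j _ => hint j j]
    refine integral_congr_ae (ae_of_all _ fun v => ?_)
    have h := b.sum_sq_norm_inner_right (v : Ambient n)
    rw [Fin.sum_univ_succ, hb, norm_eq_of_mem_sphere] at h
    simp only [Real.norm_eq_abs, sq_abs] at h
    simp only [smul_eq_mul, ← Finset.mul_sum, ← pow_two]
    congr 1
    linarith
  have hq : I i0 i0 = (n : ℝ)⁻¹ * ∫ v : Sph n, φ ‖(w : Ambient n) - v‖ *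
      (1 - inner ℝ (w : Ambient n) v ^ 2) ∂(surface n) := by
    rw [← hsum]
    simp [hdiag, hn']
  have hexp : ∀ v : Sph n, φ ‖(w : Ambient n) - v‖ •
      (conj (perp (w : Ambient n) v) * conj (perp (w : Ambient n) v)) =
      ∑ j : Fin n, ∑ k : Fin n, (φ ‖(w : Ambient n) - v‖ •
        (inner ℝ (b j.succ) (v : Ambient n) * inner ℝ (b k.succ) (v : Ambient n))) •
        (conj (b j.succ) * conj (b k.succ)) := fun v => by
    rw [perp_eq_sum hb, conj_sum, Finset.sum_mul_sum, Finset.smul_sum]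
    refine Finset.sum_congr rfl fun j _ => ?_
    rw [Finset.smul_sum]
    refine Finset.sum_congr rfl fun k _ => ?_
    rw [conj_smul, conj_smul, smul_mul_smul_comm, smul_assoc]
  simp only [hexp]
  rw [integral_finsetSum _ fun j _ => integrable_finsetSum _ fun k _ => (hint j k).smul_const _]
  have hin : ∀ j : Fin n, ∫ v : Sph n, ∑ k : Fin n, (φ ‖(w : Ambient n) - v‖ •
        (inner ℝ (b j.succ) (v : Ambient n) * inner ℝ (b k.succ) (v : Ambient n))) •
        (conj (b j.succ) * conj (b k.succ)) ∂(surface n) =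
      I i0 i0 • (conj (b j.succ) * conj (b j.succ)) := fun j => by
    rw [integral_finsetSum _ fun k _ => (hint j k).smul_const _, Finset.sum_eq_single j]
    · rw [integral_smul_const, ← hdiag j]
    · intro k _ hk
      rw [integral_smul_const]
      have := hoff j k hk.symm
      simp only [hI] at this
      rw [this, zero_smul]
    · simp
  simp only [hin]
  rw [← Finset.smul_sum, hq]
  congr 1
  have := sum_conj_sq b
  rw [Fin.sum_univ_succ, hb] at this
  rw [tangentSymbol, pow_two, ← this, add_sub_cancel_left]

/-- The reflection in the line spanned by `w`. -/
def lineReflection {n : ℕ} (w : Ambient n) : Ambient n ≃ₗᵢ[ℝ] Ambient n := (ℝ ∙ w).reflection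

theorem lineReflection_apply {n : ℕ} (w : Sph n) (v : Ambient n) :
    lineReflection (w : Ambient n) v = (2 * inner ℝ (w : Ambient n) v) • (w : Ambient n) - v := by
  rw [lineReflection, Submodule.reflection_singleton_apply]
  simp [two_mul, add_smul, two_smul]

theorem inner_self_sphere {n : ℕ} (w : Sph n) : inner ℝ (w : Ambient n) (w : Ambient n) = 1 := by
  rw [real_inner_self_eq_norm_sq, norm_eq_of_mem_sphere, one_pow]

theorem lineReflection_self {n : ℕ} (w : Sph n) : lineReflection (w : Ambient n) w = w := by
  rw [lineReflection_apply, inner_self_sphere, mul_one, two_smul, add_sub_cancel_right]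

/-! ### The Cauchy kernel and its integral over the sphere -/

theorem norm_cauchyKernel_le {n : ℕ} (y : Ambient n) :
    ‖cauchyKernel y‖ ≤ ‖conjL n‖ * weakSingularity n ‖y‖ := by
  rw [cauchyKernel, norm_smul, norm_inv, norm_pow, norm_norm, weakSingularity]
  calc _ ≤ (‖y‖ ^ n)⁻¹ * (‖conjL n‖ * ‖y‖) := by gcongr; exact norm_conj_le _
    _ = _ := by ring

theorem integrable_cauchyKernel {n : ℕ} (hn : 1 ≤ n) (w : Sph n) {g : Sph n → Cl n}
    (hg : Continuous g) :
    Integrable (fun v : Sph n => cauchyKernel ((w : Ambient n) - (v : Ambient n)) * g v) (surface n) := by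
  obtain ⟨D, hD⟩ := isCompact_univ.exists_bound_of_continuousOn hg.continuousOn
  refine ((integrable_weakSingularity hn w).const_mul (‖mulL n‖ * ‖conjL n‖ * D)).mono' ?_
    (ae_of_all _ fun v => ?_)
  · simp only [cauchyKernel, smul_mul_assoc]
    have hm : Measurable fun v : Sph n => (‖(w : Ambient n) - (v : Ambient n)‖ ^ n)⁻¹ := by fun_prop
    have hc : Continuous fun v : Sph n => conj ((w : Ambient n) - (v : Ambient n)) * g v := by
      fun_prop
    exact hm.aestronglyMeasurable.smul hc.aestronglyMeasurable
  · refine (norm_mul_le_mulL _ _).trans ?_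
    calc _ ≤ ‖mulL n‖ * (‖conjL n‖ * weakSingularity n ‖(w : Ambient n) - v‖) * D := by
          gcongr
          · have := weakSingularity_nonneg (n := n) (norm_nonneg ((w : Ambient n) - v))
            positivity
          · exact norm_cauchyKernel_le _
          · exact hD v (mem_univ _)
      _ = _ := by ring

/-- Average over the reflection `R` in the line `ℝ w`: `(w - v) + (w - R v) = ‖w - v‖² w`, while the
distance to `w` is unchanged. Hence the integral is half of `4 ω_n / n`, times `w̄`. -/
theorem integral_cauchyKernel {n : ℕ} (hn : 1 ≤ n) (w : Sph n) :
    ∫ v : Sph n, cauchyKernel ((w : Ambient n) - (v : Ambient n)) ∂(surface n) =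
      (omega n * (2 / n)) • conj (w : Ambient n) := by
  have hi : Integrable (fun v : Sph n => cauchyKernel ((w : Ambient n) - (v : Ambient n))) (surface n) := by
    simpa using integrable_cauchyKernel hn w (g := fun _ => 1) continuous_const
  have h := integral_comp_isometry_fixing (lineReflection_self w) (fun r => (r ^ n)⁻¹)
    (fun v => conj ((w : Ambient n) - v))
  have hpt : ∀ v : Sph n, (‖(w : Ambient n) - v‖ ^ n)⁻¹ •
      conj ((w : Ambient n) - lineReflection (w : Ambient n) v) =
      (‖(w : Ambient n) - v‖ ^ 2 * (‖(w : Ambient n) - v‖ ^ n)⁻¹) • conj (w : Ambient n) -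
        cauchyKernel ((w : Ambient n) - (v : Ambient n)) := fun v => by
    have hv : (w : Ambient n) - lineReflection (w : Ambient n) v =
        ‖(w : Ambient n) - v‖ ^ 2 • (w : Ambient n) - ((w : Ambient n) - v) := by
      rw [lineReflection_apply, norm_sub_sq_sphere]
      module
    rw [cauchyKernel, mul_comm, ← smul_smul, ← smul_sub, hv, conj_sub _ ((w : Ambient n) - (v : Ambient n)),
      conj_smul]
  have hJ := integral_norm_sub_sq_div hn w
  have hJi := integrable_norm_sub_sq_div hn w
  simp only [hpt] at h
  rw [integral_sub (hJi.smul_const _) hi, integral_smul_const, hJ] at h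
  have h' : (omega n * (4 / n)) • conj (w : Ambient n) =
      (2 : ℝ) • ∫ v : Sph n, cauchyKernel ((w : Ambient n) - (v : Ambient n)) ∂(surface n) := by
    rw [sub_eq_iff_eq_add] at h
    rw [h, two_smul]; rfl
  rw [← inv_smul_eq_iff₀ two_ne_zero] at h'
  rw [← h', smul_smul]
  congr 1
  ring

/-- The kernel of the principal value, `A + n B`. -/
def kernelSum {n : ℕ} (w v : Ambient n) : Cl n := kernelA w v + (n : ℝ) • kernelB w v

/-! ### Truncated integrals of the singular kernels -/

theorem kernelB_eq {n : ℕ} (w v : Ambient n) :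
    kernelB w v = (‖w - v‖ ^ (n + 2))⁻¹ • (conj (perp w v) * conj (w - v)) := by
  rw [kernelB, smul_mul_smul_comm, ← mul_inv, ← pow_succ, perp, conj_sub v, conj_smul]

theorem kernelA_eq {n : ℕ} (w v : Ambient n) :
    kernelA w v = (‖w - v‖ ^ n)⁻¹ • tangentSymbol w := rfl

theorem continuous_perp {n : ℕ} (w : Ambient n) : Continuous (perp w) := by
  unfold perp; fun_prop

theorem measurableSet_outside {n : ℕ} (w : Sph n) (ε : ℝ) : MeasurableSet (outside w ε) :=
  measurableSet_lt measurable_const (by fun_prop)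

/-- The truncation is itself a function of `‖w - v‖`, so it can be absorbed into the weight and the
symmetry lemmas apply to truncated integrals. -/
theorem indicator_outside {n : ℕ} {F : Type*} [AddCommGroup F] [Module ℝ F] (w : Sph n) (ε : ℝ)
    (g : Sph n → F) (φ : ℝ → ℝ) :
    (outside w ε).indicator (fun v => φ ‖(w : Ambient n) - v‖ • g v) =
      fun v : Sph n => (Ioi ε).indicator φ ‖(w : Ambient n) - v‖ • g v := by
  ext v
  by_cases h : ε < ‖(w : Ambient n) - v‖
  · rw [indicator_of_mem (show v ∈ outside w ε from h), indicator_of_mem (mem_Ioi.mpr h)]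
  · rw [indicator_of_notMem (show v ∉ outside w ε from h), indicator_of_notMem (mt mem_Ioi.mp h),
      zero_smul]

theorem abs_indicator_inv_pow_le {ε : ℝ} (hε : 0 < ε) (k : ℕ) (r : ℝ) :
    |(Ioi ε).indicator (fun r : ℝ => (r ^ k)⁻¹) r| ≤ (ε ^ k)⁻¹ := by
  by_cases h : ε < r
  · rw [indicator_of_mem (mem_Ioi.mpr h), abs_of_nonneg (by have := hε.trans h; positivity)]
    gcongr
  · rw [indicator_of_notMem (mt mem_Ioi.mp h), abs_zero]; positivity

theorem measurable_indicator_inv_pow (ε : ℝ) (k : ℕ) :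
    Measurable ((Ioi ε).indicator fun r : ℝ => (r ^ k)⁻¹) :=
  Measurable.indicator (by fun_prop) measurableSet_Ioi

theorem integrableOn_outside_inv_pow_smul {n : ℕ} {F : Type*} [NormedAddCommGroup F]
    [NormedSpace ℝ F] (w : Sph n) {ε : ℝ} (hε : 0 < ε) (k : ℕ) {g : Sph n → F}
    (hg : Continuous g) :
    IntegrableOn (fun v : Sph n => (‖(w : Ambient n) - v‖ ^ k)⁻¹ • g v) (outside w ε)
      (surface n) := by
  rw [← integrable_indicator_iff (measurableSet_outside w ε),
    indicator_outside w ε g fun r => (r ^ k)⁻¹]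
  exact integrable_smul_of_bounded w (measurable_indicator_inv_pow ε k)
    (abs_indicator_inv_pow_le hε k) hg

theorem integrableOn_kernelA {n : ℕ} (w : Sph n) {ε : ℝ} (hε : 0 < ε) {g : Sph n → Cl n}
    (hg : Continuous g) :
    IntegrableOn (fun v : Sph n => kernelA (w : Ambient n) v * g v) (outside w ε) (surface n) := by
  simp only [kernelA_eq, smul_mul_assoc]
  exact integrableOn_outside_inv_pow_smul w hε n (by fun_prop)

theorem integrableOn_kernelB {n : ℕ} (w : Sph n) {ε : ℝ} (hε : 0 < ε) {g : Sph n → Cl n}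
    (hg : Continuous g) :
    IntegrableOn (fun v : Sph n => kernelB (w : Ambient n) v * g v) (outside w ε) (surface n) := by
  simp only [kernelB_eq, smul_mul_assoc]
  have := continuous_perp (w : Ambient n)
  exact integrableOn_outside_inv_pow_smul w hε (n + 2) (by fun_prop)

theorem perp_lineReflection {n : ℕ} (w : Sph n) (v : Ambient n) :
    perp (w : Ambient n) (lineReflection (w : Ambient n) v) = - perp (w : Ambient n) v := by
  rw [perp, perp, lineReflection_apply, inner_sub_right, inner_smul_right, inner_self_sphere]
  module

theorem inner_lineReflection {n : ℕ} (w : Sph n) (v : Ambient n) :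
    inner ℝ (w : Ambient n) (lineReflection (w : Ambient n) v) = inner ℝ (w : Ambient n) v := by
  rw [lineReflection_apply, inner_sub_right, inner_smul_right, inner_self_sphere]
  ring

theorem self_sub_eq {n : ℕ} (w : Ambient n) (v : Ambient n) :
    w - v = (1 - inner ℝ w v) • w - perp w v := by
  rw [perp]; module

/-- Put `r = ‖w - v‖` and `s = ⟨w, v⟩`, and split `w - v` into normal and tangential parts. The
normal part contributes an odd integrand to `B`; the tangential one gives `-(1/n) r^{-n-2} (1 - s²)`
after averaging. As `1 - s² = r² (1 - r²/4)`, the `r^{-n}` of `A` cancels and `r^{2-n}/4` is left.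
-/
theorem integral_outside_kernelSum {n : ℕ} (hn : 1 ≤ n) (w : Sph n) {ε : ℝ} (hε : 0 < ε) :
    ∫ v in outside w ε, kernelSum (w : Ambient n) (v : Ambient n) ∂(surface n) =
      ((1 / 4) * ∫ v in outside w ε,
        ‖(w : Ambient n) - v‖ ^ 2 * (‖(w : Ambient n) - v‖ ^ n)⁻¹ ∂(surface n)) •
        tangentSymbol (w : Ambient n) := by
  have hcp := continuous_perp (w : Ambient n)
  have hn' : (n : ℝ) ≠ 0 := by exact_mod_cast (by omega : n ≠ 0)
  set φ : ℝ → ℝ := (Ioi ε).indicator fun r : ℝ => (r ^ (n + 2))⁻¹ with hφ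
  have hint : ∀ {g : Sph n → Cl n}, Continuous g → Integrable (fun v : Sph n =>
      φ ‖(w : Ambient n) - v‖ • g v) (surface n) := fun hg =>
    integrable_smul_of_bounded w (measurable_indicator_inv_pow ε (n + 2))
      (abs_indicator_inv_pow_le hε _) hg
  -- The reflection in the line `ℝ w` keeps `⟨w, v⟩` and reverses the tangential part.
  have hlin : ∫ v : Sph n, φ ‖(w : Ambient n) - v‖ •
      ((1 - inner ℝ (w : Ambient n) v) • (conj (perp (w : Ambient n) v) * conj (w : Ambient n)))
      ∂(surface n) = 0 := by
    have h := integral_comp_isometry_fixing (lineReflection_self w) φ (fun v =>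
      (1 - inner ℝ (w : Ambient n) v) • (conj (perp (w : Ambient n) v) * conj (w : Ambient n)))
    simp only [inner_lineReflection, perp_lineReflection, conj_neg, neg_mul, smul_neg, integral_neg] at h
    have h2 := add_eq_zero_iff_eq_neg.mpr h.symm
    rw [← two_smul ℝ] at h2
    exact (smul_eq_zero_iff_right two_ne_zero).mp h2
  have hB : ∫ v in outside w ε, kernelB (w : Ambient n) (v : Ambient n) ∂(surface n) =
      -(((n : ℝ)⁻¹ * ∫ v : Sph n, φ ‖(w : Ambient n) - v‖ *
        (1 - inner ℝ (w : Ambient n) v ^ 2) ∂(surface n)) • tangentSymbol (w : Ambient n)) := by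
    rw [← integral_conj_perp_sq hn w (measurable_indicator_inv_pow ε (n + 2))
      (abs_indicator_inv_pow_le hε _), ← integral_indicator (measurableSet_outside w ε)]
    simp only [kernelB_eq]
    rw [indicator_outside w ε (fun v : Sph n => conj (perp (w : Ambient n) v) *
      conj ((w : Ambient n) - (v : Ambient n))) fun r => (r ^ (n + 2))⁻¹]
    have hpt : ∀ v : Sph n, conj (perp (w : Ambient n) v) * conj ((w : Ambient n) - (v : Ambient n))
        = (1 - inner ℝ (w : Ambient n) v) • (conj (perp (w : Ambient n) v) * conj (w : Ambient n))
          - conj (perp (w : Ambient n) v) * conj (perp (w : Ambient n) v) := fun v => by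
      rw [self_sub_eq (w : Ambient n) v, conj_sub, conj_smul, mul_sub, mul_smul_comm]
    simp only [hpt, smul_sub]
    rw [integral_sub (hint (by fun_prop)) (hint (by fun_prop)), hlin, zero_sub]
  have hA : ∫ v in outside w ε, kernelA (w : Ambient n) (v : Ambient n) ∂(surface n) =
      (∫ v in outside w ε, (‖(w : Ambient n) - v‖ ^ n)⁻¹ ∂(surface n)) •
        tangentSymbol (w : Ambient n) := by
    simp only [kernelA_eq]
    rw [integral_smul_const]
  have hAi := integrableOn_kernelA w hε (g := fun _ => 1) continuous_const
  have hBi := integrableOn_kernelB w hε (g := fun _ => 1) continuous_const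
  simp only [mul_one] at hAi hBi
  simp only [kernelSum]
  rw [integral_add hAi (hBi.fun_smul (n : ℝ)), integral_smul, hA, hB, smul_neg, smul_smul,
    mul_inv_cancel_left₀ hn', ← sub_eq_add_neg, ← sub_smul]
  congr 1
  have hφ2 : ∫ v : Sph n, φ ‖(w : Ambient n) - v‖ * (1 - inner ℝ (w : Ambient n) v ^ 2) ∂(surface n)
      = ∫ v in outside w ε, (‖(w : Ambient n) - v‖ ^ (n + 2))⁻¹ •
        (1 - inner ℝ (w : Ambient n) (v : Ambient n) ^ 2) ∂(surface n) := by
    rw [← integral_indicator (measurableSet_outside w ε),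
      indicator_outside w ε (fun v : Sph n => 1 - inner ℝ (w : Ambient n) (v : Ambient n) ^ 2)
      fun r => (r ^ (n + 2))⁻¹]
    rfl
  have h1 := integrableOn_outside_inv_pow_smul w hε n (g := fun _ => (1 : ℝ)) continuous_const
  have h2 := integrableOn_outside_inv_pow_smul w hε (n + 2)
    (g := fun v : Sph n => 1 - inner ℝ (w : Ambient n) (v : Ambient n) ^ 2) (by fun_prop)
  simp only [smul_eq_mul, mul_one] at h1 h2 hφ2
  rw [hφ2, ← integral_sub h1 h2, ← integral_const_mul]
  refine setIntegral_congr_fun (measurableSet_outside w ε) fun v hv => ?_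
  have hr : 0 < ‖(w : Ambient n) - v‖ := hε.trans hv
  rw [norm_sub_mul_four_sub, pow_add]
  field_simp
  ring

/-! ### Differentiation under the integral sign -/

/-- The derivative `τ ↦ τ̄ / ‖y‖ⁿ - n ⟨y, τ⟩ ȳ / ‖y‖^{n+2}` of the Cauchy kernel at `y`. -/
def dKernel {n : ℕ} (y : Ambient n) : Ambient n →L[ℝ] Cl n :=
  (‖y‖ ^ n)⁻¹ • conjL n - (n * (‖y‖ ^ (n + 2))⁻¹) • (innerSL ℝ y).smulRight (conj y)

theorem dKernel_apply {n : ℕ} (y τ : Ambient n) :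
    dKernel y τ = (‖y‖ ^ n)⁻¹ • conj τ - (n * (‖y‖ ^ (n + 2))⁻¹) • inner ℝ y τ • conj y := rfl

theorem hasFDerivAt_cauchyKernel {n : ℕ} {y : Ambient n} (hy : y ≠ 0) :
    HasFDerivAt cauchyKernel (dKernel y) y := by
  have hy' : 0 < ‖y‖ := norm_pos_iff.mpr hy
  have h1 : HasFDerivAt (fun x : Ambient n => ‖x‖) (‖y‖⁻¹ • innerSL ℝ y) y := by
    have h := (hasStrictFDerivAt_norm_sq y).hasFDerivAt.sqrt (by positivity)
    simp only [Real.sqrt_sq (norm_nonneg _)] at h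
    refine h.congr_fderiv ?_
    rw [← Nat.cast_smul_eq_nsmul ℝ, smul_smul]
    congr 1
    push_cast
    field_simp
  have h2 : HasDerivAt (fun u : ℝ => (u ^ n)⁻¹) (-(n * ‖y‖ ^ (n - 1)) / (‖y‖ ^ n) ^ 2) ‖y‖ :=
    (hasDerivAt_pow n ‖y‖).inv (by positivity)
  have h3 := (h2.comp_hasFDerivAt y h1).smul (conjL n).hasFDerivAt
  refine h3.congr_fderiv ?_
  ext τ
  rw [dKernel_apply]
  simp only [Function.comp_apply, add_apply, smul_apply,
    ContinuousLinearMap.smulRight_apply, conjL_apply, innerSL_apply_apply, smul_eq_mul, smul_smul]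
  rw [sub_eq_add_neg, ← neg_smul]
  congr 2
  -- The exponent `n - 1` is truncated subtraction; for `n = 0` its coefficient vanishes.
  rcases n with _ | k
  · simp
  · rw [Nat.add_sub_cancel]
    field_simp
    ring

theorem norm_dKernel_le {n : ℕ} (y : Ambient n) :
    ‖dKernel y‖ ≤ ((1 + n) * ‖conjL n‖) * (‖y‖ ^ n)⁻¹ := by
  have h1 : ‖(innerSL ℝ y).smulRight (conj y)‖ ≤ ‖y‖ * (‖conjL n‖ * ‖y‖) := by
    rw [ContinuousLinearMap.norm_smulRight_apply, innerSL_apply_norm]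
    gcongr
    exact norm_conj_le y
  have h2 : (‖y‖ ^ (n + 2))⁻¹ * ‖y‖ ^ 2 ≤ (‖y‖ ^ n)⁻¹ := by
    rcases (norm_nonneg y).eq_or_lt with h | h
    · rw [← h]; simp
    · apply le_of_eq; rw [pow_add]; field_simp
  calc ‖dKernel y‖ ≤ ‖(‖y‖ ^ n)⁻¹ • conjL n‖ +
        ‖(n * (‖y‖ ^ (n + 2))⁻¹) • (innerSL ℝ y).smulRight (conj y)‖ := norm_sub_le _ _
    _ ≤ (‖y‖ ^ n)⁻¹ * ‖conjL n‖ + (n * (‖y‖ ^ (n + 2))⁻¹) * (‖y‖ * (‖conjL n‖ * ‖y‖)) := by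
        rw [norm_smul, norm_smul, Real.norm_of_nonneg (by positivity),
          Real.norm_of_nonneg (by positivity)]
        gcongr
    _ = (‖y‖ ^ n)⁻¹ * ‖conjL n‖ + n * ‖conjL n‖ * ((‖y‖ ^ (n + 2))⁻¹ * ‖y‖ ^ 2) := by ring
    _ ≤ (‖y‖ ^ n)⁻¹ * ‖conjL n‖ + n * ‖conjL n‖ * (‖y‖ ^ n)⁻¹ := by gcongr
    _ = _ := by ring

/-- Mean value inequality on the ball of radius `‖y‖/2` around `y`, where norms stay above `‖y‖/2`;
this is the source of `2 ^ n`. -/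
theorem norm_cauchyKernel_sub_le {n : ℕ} {y z : Ambient n} (hyz : ‖z - y‖ < ‖y‖ / 2) :
    ‖cauchyKernel z - cauchyKernel y‖ ≤
      ((1 + n) * ‖conjL n‖) * (2 ^ n * (‖y‖ ^ n)⁻¹) * ‖z - y‖ := by
  have hy : 0 < ‖y‖ := by linarith [norm_nonneg (z - y)]
  have hb : ∀ x ∈ ball y (‖y‖ / 2), ‖y‖ / 2 ≤ ‖x‖ := fun x hx => by
    rw [mem_ball, dist_eq_norm] at hx
    have := norm_sub_norm_le y x
    rw [norm_sub_rev] at this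
    linarith
  refine (convex_ball y (‖y‖ / 2)).norm_image_sub_le_of_norm_hasFDerivWithin_le
    (f' := dKernel) (fun x hx => (hasFDerivAt_cauchyKernel ?_).hasFDerivWithinAt)
    (fun x hx => (norm_dKernel_le x).trans ?_) (mem_ball_self (by positivity))
    (by rwa [mem_ball, dist_eq_norm])
  · have := hb x hx
    exact norm_pos_iff.mp (by linarith)
  · have := hb x hx
    rw [← inv_inv (2 ^ n : ℝ), ← mul_inv, inv_mul_eq_div, ← div_pow]
    gcongr

/-- The integrand of the derivative of the Cauchy transform of `h`. -/
def dIntegrand {n : ℕ} (h : Sph n → Cl n) (w v : Sph n) : Ambient n →L[ℝ] Cl n :=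
  ((mulL n).flip (h v)).comp (dKernel ((w : Ambient n) - (v : Ambient n)))

theorem dIntegrand_apply {n : ℕ} (h : Sph n → Cl n) (w v : Sph n) (τ : Ambient n) :
    dIntegrand h w v τ = dKernel ((w : Ambient n) - (v : Ambient n)) τ * h v := rfl

theorem norm_dIntegrand_le {n : ℕ} {h : Sph n → Cl n} {w : Sph n} {C : ℝ}
    (hC : ∀ v : Sph n, ‖h v‖ ≤ C * ‖(w : Ambient n) - v‖) (v : Sph n) :
    ‖dIntegrand h w v‖ ≤ ‖mulL n‖ * ((1 + n) * ‖conjL n‖) * C *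
      weakSingularity n ‖(w : Ambient n) - v‖ := by
  refine (ContinuousLinearMap.opNorm_comp_le _ _).trans ?_
  have h1 : ‖(mulL n).flip (h v)‖ ≤ ‖mulL n‖ * (C * ‖(w : Ambient n) - v‖) := by
    refine ((mulL n).flip.le_opNorm _).trans ?_
    rw [ContinuousLinearMap.opNorm_flip]
    gcongr
    exact hC v
  calc _ ≤ (‖mulL n‖ * (C * ‖(w : Ambient n) - v‖)) *
        (((1 + n) * ‖conjL n‖) * (‖(w : Ambient n) - v‖ ^ n)⁻¹) := by
        gcongr
        · exact (norm_nonneg _).trans h1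
        · exact norm_dKernel_le _
    _ = _ := by rw [weakSingularity]; ring

theorem integrable_dIntegrand {n : ℕ} (hn : 1 ≤ n) {h : Sph n → Cl n} (hcont : Continuous h)
    {w : Sph n} {C : ℝ} (hC : ∀ v : Sph n, ‖h v‖ ≤ C * ‖(w : Ambient n) - v‖) :
    Integrable (dIntegrand h w) (surface n) := by
  refine ((integrable_weakSingularity hn w).const_mul
    (‖mulL n‖ * ((1 + n) * ‖conjL n‖) * C)).mono' ?_ (ae_of_all _ (norm_dIntegrand_le hC))
  -- Measurability: singular scalar factors times continuous operator-valued functions.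
  have h1 : dIntegrand h w = fun v : Sph n =>
      (‖(w : Ambient n) - (v : Ambient n)‖ ^ n)⁻¹ • ((mulL n).flip (h v)).comp (conjL n) -
      (n * (‖(w : Ambient n) - (v : Ambient n)‖ ^ (n + 2))⁻¹) •
        ContinuousLinearMap.smulRightL ℝ (Ambient n) (Cl n)
          (innerSL ℝ ((w : Ambient n) - (v : Ambient n)))
          (conj ((w : Ambient n) - (v : Ambient n)) * h v) := by
    ext v τ
    simp only [dIntegrand_apply, dKernel_apply, sub_mul, smul_mul_assoc]
    rfl
  rw [h1]
  have m1 : Measurable fun v : Sph n => (‖(w : Ambient n) - (v : Ambient n)‖ ^ n)⁻¹ := by fun_prop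
  have m2 : Measurable fun v : Sph n =>
    ((n : ℝ) * (‖(w : Ambient n) - (v : Ambient n)‖ ^ (n + 2))⁻¹) := by fun_prop
  have c1 : Continuous fun v : Sph n => ((mulL n).flip (h v)).comp (conjL n) := by fun_prop
  have c2 : Continuous fun v : Sph n => ContinuousLinearMap.smulRightL ℝ (Ambient n) (Cl n)
          (innerSL ℝ ((w : Ambient n) - (v : Ambient n)))
          (conj ((w : Ambient n) - (v : Ambient n)) * h v) := by fun_prop
  exact (m1.aestronglyMeasurable.smul c1.aestronglyMeasurable).sub
    (m2.aestronglyMeasurable.smul c2.aestronglyMeasurable)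

/-- The first-order remainder of the integrand of the Cauchy transform. -/
def remainder {n : ℕ} (h : Sph n → Cl n) (w : Sph n) (x : Ambient n) (v : Sph n) : Cl n :=
  cauchyKernel (x - (v : Ambient n)) * h v - cauchyKernel ((w : Ambient n) - (v : Ambient n)) * h v
    - dIntegrand h w v (x - w)

theorem remainder_eq {n : ℕ} (h : Sph n → Cl n) (w : Sph n) (x : Ambient n) (v : Sph n) :
    remainder h w x v = (cauchyKernel (x - (v : Ambient n)) -
      cauchyKernel ((w : Ambient n) - (v : Ambient n)) -
      dKernel ((w : Ambient n) - (v : Ambient n)) (x - w)) * h v := by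
  rw [remainder, dIntegrand_apply, sub_mul, sub_mul]

theorem norm_remainder_far_le {n : ℕ} {h : Sph n → Cl n} {w : Sph n} {C : ℝ}
    (hC : ∀ v : Sph n, ‖h v‖ ≤ C * ‖(w : Ambient n) - v‖) {x : Ambient n} {v : Sph n}
    (hfar : 2 * ‖x - w‖ < ‖(w : Ambient n) - v‖) :
    ‖remainder h w x v‖ ≤ (‖mulL n‖ * ((1 + n) * ‖conjL n‖) * C * (2 ^ n + 1)) *
      weakSingularity n ‖(w : Ambient n) - v‖ * ‖x - w‖ := by
  set r := ‖(w : Ambient n) - v‖ with hr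
  have h1 : ‖cauchyKernel (x - (v : Ambient n)) - cauchyKernel ((w : Ambient n) - (v : Ambient n))‖ ≤
      ((1 + n) * ‖conjL n‖) * (2 ^ n * (r ^ n)⁻¹) * ‖x - w‖ := by
    have := norm_cauchyKernel_sub_le (y := (w : Ambient n) - (v : Ambient n))
      (z := x - (v : Ambient n))
      (by rw [sub_sub_sub_cancel_right, ← hr]; linarith)
    rwa [sub_sub_sub_cancel_right] at this
  have h2 : ‖dKernel ((w : Ambient n) - (v : Ambient n)) (x - w)‖ ≤
      ((1 + n) * ‖conjL n‖) * (r ^ n)⁻¹ * ‖x - w‖ :=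
    (ContinuousLinearMap.le_opNorm _ _).trans (by gcongr; exact norm_dKernel_le _)
  rw [remainder_eq]
  calc _ ≤ ‖mulL n‖ * (((1 + n) * ‖conjL n‖) * (2 ^ n * (r ^ n)⁻¹) * ‖x - w‖ +
        ((1 + n) * ‖conjL n‖) * (r ^ n)⁻¹ * ‖x - w‖) * (C * r) := by
        refine (norm_mul_le_mulL _ _).trans ?_
        gcongr
        · exact (norm_sub_le _ _).trans (add_le_add h1 h2)
        · exact hC v
    _ = _ := by rw [weakSingularity]; ring

/-- Here `‖h v‖ ≤ 2C ‖x - w‖` supplies the factor `‖x - w‖`, and each Cauchy kernel can be bounded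
separately by a weak singularity, at `x` or at `w`. No difference estimate is available, as `x` may
be close to `v`. -/
theorem norm_remainder_near_le {n : ℕ} {h : Sph n → Cl n} {w : Sph n} {C : ℝ} (hC0 : 0 ≤ C)
    (hC : ∀ v : Sph n, ‖h v‖ ≤ C * ‖(w : Ambient n) - v‖) {x : Ambient n} {v : Sph n}
    (hnear : ‖(w : Ambient n) - v‖ ≤ 2 * ‖x - w‖) :
    ‖remainder h w x v‖ ≤ (‖mulL n‖ * ‖conjL n‖ * C * 2 *
      (weakSingularity n ‖x - (v : Ambient n)‖ + weakSingularity n ‖(w : Ambient n) - v‖) +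
      ‖mulL n‖ * ((1 + n) * ‖conjL n‖) * C * weakSingularity n ‖(w : Ambient n) - v‖)
        * ‖x - w‖ := by
  have hh : ‖h v‖ ≤ C * (2 * ‖x - w‖) := (hC v).trans (by gcongr)
  have hG : ∀ y : Ambient n, ‖cauchyKernel y * h v‖ ≤
      ‖mulL n‖ * (‖conjL n‖ * weakSingularity n ‖y‖) * (C * (2 * ‖x - w‖)) := fun y => by
    refine (norm_mul_le_mulL _ _).trans ?_
    have := weakSingularity_nonneg (n := n) (norm_nonneg y)
    gcongr
    exact norm_cauchyKernel_le y
  have hd : ‖dIntegrand h w v (x - w)‖ ≤ ‖mulL n‖ * ((1 + n) * ‖conjL n‖) * C *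
      weakSingularity n ‖(w : Ambient n) - v‖ * ‖x - w‖ :=
    (ContinuousLinearMap.le_opNorm _ _).trans (by gcongr; exact norm_dIntegrand_le hC v)
  calc _ ≤ ‖cauchyKernel (x - (v : Ambient n)) * h v‖ +
        ‖cauchyKernel ((w : Ambient n) - (v : Ambient n)) * h v‖ + ‖dIntegrand h w v (x - w)‖ :=
        (norm_sub_le _ _).trans (by gcongr; exact norm_sub_le _ _)
    _ ≤ _ := add_le_add (add_le_add (hG _) (hG _)) hd
    _ = _ := by ring

theorem tendsto_remainder {n : ℕ} {h : Sph n → Cl n} {w : Sph n} (hw : h w = 0) (v : Sph n) :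
    Tendsto (fun x : Ambient n => ‖x - w‖⁻¹ * ‖remainder h w x v‖) (𝓝 (w : Ambient n)) (𝓝 0) := by
  by_cases hv : v = w
  · subst hv
    simp [remainder_eq, hw]
  · have hne : (w : Ambient n) - v ≠ 0 := sub_ne_zero.mpr fun hh => hv (Subtype.ext hh.symm)
    have h1 : HasFDerivAt (fun x : Ambient n => cauchyKernel (x - (v : Ambient n)))
        (dKernel ((w : Ambient n) - (v : Ambient n))) (w : Ambient n) :=
      (HasFDerivAt.comp (w : Ambient n) (hasFDerivAt_cauchyKernel hne)
        ((hasFDerivAt_id _).sub_const (v : Ambient n))).congr_fderiv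
        (ContinuousLinearMap.comp_id _)
    have h2 := hasFDerivAt_iff_tendsto.mp h1
    have h3 := h2.const_mul (‖mulL n‖ * ‖h v‖)
    rw [mul_zero] at h3
    refine squeeze_zero (fun x => by positivity) (fun x => ?_) h3
    rw [remainder_eq]
    calc _ ≤ ‖x - w‖⁻¹ * (‖mulL n‖ * ‖cauchyKernel (x - (v : Ambient n)) -
          cauchyKernel ((w : Ambient n) - (v : Ambient n)) -
          dKernel ((w : Ambient n) - (v : Ambient n)) (x - w)‖ * ‖h v‖) := by
          gcongr; exact norm_mul_le_mulL _ _
      _ = _ := by ring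

/-- The remainder divided by `δ = ‖x - w‖` is split at `‖w - v‖ = 2δ`. The far part tends to zero by
dominated convergence; the near part is bounded by integrals of weak singularities over caps of
radius `O(δ)`. The cap around `x` is controlled by rotation invariance, which is why `x` stays on
the sphere. -/
theorem hasFDerivWithinAt_cauchyIntegral {n : ℕ} (hn : 1 ≤ n) {h : Sph n → Cl n}
    (hcont : Continuous h) {w : Sph n} {C : ℝ} (hC0 : 0 ≤ C)
    (hC : ∀ v : Sph n, ‖h v‖ ≤ C * ‖(w : Ambient n) - v‖) :
    HasFDerivWithinAt (fun x : Ambient n =>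
        ∫ v : Sph n, cauchyKernel (x - (v : Ambient n)) * h v ∂(surface n))
      (∫ v, dIntegrand h w v ∂(surface n)) (sphere 0 1) (w : Ambient n) := by
  have hw : h w = 0 := by simpa using hC w
  have hdi := integrable_dIntegrand hn hcont hC
  have hGi : ∀ x : Sph n, Integrable (fun v : Sph n =>
      cauchyKernel ((x : Ambient n) - (v : Ambient n)) * h v) (surface n) := fun x =>
    integrable_cauchyKernel hn x hcont
  have hri : ∀ x : Sph n, Integrable (remainder h w x) (surface n) := fun x =>
    ((hGi x).sub (hGi w)).sub (hdi.apply_continuousLinearMap _)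
  set far : Ambient n → Sph n → ℝ := fun x v =>
    {v : Sph n | 2 * ‖x - w‖ < ‖(w : Ambient n) - v‖}.indicator
      (fun v => ‖x - w‖⁻¹ * ‖remainder h w x v‖) v with hfar
  have hset : ∀ x : Ambient n,
      MeasurableSet {v : Sph n | 2 * ‖x - w‖ < ‖(w : Ambient n) - v‖} := fun x =>
    measurableSet_lt measurable_const (by fun_prop)
  have hfari : ∀ x : Sph n, Integrable (far x) (surface n) := fun x =>
    ((hri x).norm.const_mul _).indicator (hset x)
  set K1 := ‖mulL n‖ * ‖conjL n‖ * C * 2 with hK1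
  set K2 := ‖mulL n‖ * ((1 + n) * ‖conjL n‖) * C with hK2
  have hK1p : 0 ≤ K1 := by positivity
  have hK2p : 0 ≤ K2 := by positivity
  have hfarlim : Tendsto (fun x : Ambient n => ∫ v, far x v ∂(surface n))
      (𝓝[sphere 0 1] (w : Ambient n)) (𝓝 0) := by
    suffices H : Tendsto (fun x : Ambient n => ∫ v, far x v ∂(surface n))
        (𝓝[sphere 0 1] (w : Ambient n)) (𝓝 (∫ _ : Sph n, (0 : ℝ) ∂(surface n))) by simpa using H
    refine tendsto_integral_filter_of_dominated_convergence
      (fun v : Sph n => (K2 * (2 ^ n + 1)) * weakSingularity n ‖(w : Ambient n) - v‖)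
      ?_ ?_ ((integrable_weakSingularity hn w).const_mul _) (ae_of_all _ fun v => ?_)
    · filter_upwards [self_mem_nhdsWithin] with x hx
      exact (hfari ⟨x, hx⟩).aestronglyMeasurable
    · refine Eventually.of_forall fun x => ae_of_all _ fun v => ?_
      have hp : 0 ≤ (K2 * (2 ^ n + 1)) * weakSingularity n ‖(w : Ambient n) - v‖ :=
        mul_nonneg (by positivity) (weakSingularity_nonneg (norm_nonneg _))
      by_cases hv : 2 * ‖x - w‖ < ‖(w : Ambient n) - v‖
      · simp only [hfar]
        rw [indicator_of_mem (by exact hv), Real.norm_of_nonneg (by positivity)]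
        rcases (norm_nonneg (x - (w : Ambient n))).eq_or_lt with h0 | h0
        · rw [← h0]; simpa using hp
        · rw [inv_mul_le_iff₀ h0, mul_comm ‖x - (w : Ambient n)‖]
          exact norm_remainder_far_le hC hv
      · simp only [hfar]
        rw [indicator_of_notMem (by exact hv), norm_zero]
        exact hp
    · refine squeeze_zero (fun x => indicator_nonneg (fun _ _ => by positivity) _) (fun x => ?_)
        ((tendsto_remainder hw v).mono_left nhdsWithin_le_nhds)
      exact indicator_le_self' (fun _ _ => by positivity) _
  have hδ : Tendsto (fun x : Ambient n => ‖x - w‖) (𝓝[sphere 0 1] (w : Ambient n)) (𝓝 0) := by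
    have : Continuous fun x : Ambient n => ‖x - w‖ := by fun_prop
    simpa using (this.tendsto (w : Ambient n)).mono_left nhdsWithin_le_nhds
  have hcap : ∀ c : ℝ, Tendsto (fun x : Ambient n => capIntegral w (c * ‖x - w‖))
      (𝓝[sphere 0 1] (w : Ambient n)) (𝓝 0) := fun c =>
    (tendsto_capIntegral hn w).comp (by simpa using hδ.const_mul c)
  have hbound : Tendsto (fun x : Ambient n => (K1 * capIntegral w (3 * ‖x - w‖) +
      (K1 + K2) * capIntegral w (2 * ‖x - w‖)) + ∫ v, far x v ∂(surface n))
      (𝓝[sphere 0 1] (w : Ambient n)) (𝓝 0) := by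
    simpa using (((hcap 3).const_mul K1).add ((hcap 2).const_mul (K1 + K2))).add hfarlim
  rw [hasFDerivWithinAt_iff_tendsto]
  refine squeeze_zero' (Eventually.of_forall fun x => by positivity) ?_ hbound
  filter_upwards [self_mem_nhdsWithin] with x hx
  lift x to Sph n using hx
  set δ := ‖(x : Ambient n) - w‖ with hδdef
  have hrem : ∫ v : Sph n, cauchyKernel ((x : Ambient n) - (v : Ambient n)) * h v ∂(surface n) -
      ∫ v : Sph n, cauchyKernel ((w : Ambient n) - (v : Ambient n)) * h v ∂(surface n) -
      (∫ v, dIntegrand h w v ∂(surface n)) ((x : Ambient n) - w) =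
      ∫ v, remainder h w x v ∂(surface n) := by
    have hsub : Integrable (fun v : Sph n => cauchyKernel ((x : Ambient n) - (v : Ambient n)) * h v
        - cauchyKernel ((w : Ambient n) - (v : Ambient n)) * h v) (surface n) :=
      (hGi x).sub (hGi w)
    rw [ContinuousLinearMap.integral_apply hdi, ← integral_sub (hGi x) (hGi w),
      ← integral_sub hsub (hdi.apply_continuousLinearMap _)]
    rfl
  rw [hrem]
  have hcapx : capIntegral w (3 * δ) = capIntegral x (3 * δ) :=
    integral_fun_norm_sub_congr w x _
  have i1 := (integrable_indicator_weakSingularity hn x (3 * δ)).const_mul K1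
  have i2 := (integrable_indicator_weakSingularity hn w (2 * δ)).const_mul (K1 + K2)
  have i3 : Integrable (fun v : Sph n =>
      K1 * (Iic (3 * δ)).indicator (weakSingularity n) ‖(x : Ambient n) - v‖ +
      (K1 + K2) * (Iic (2 * δ)).indicator (weakSingularity n) ‖(w : Ambient n) - v‖)
      (surface n) := i1.add i2
  calc δ⁻¹ * ‖∫ v, remainder h w x v ∂(surface n)‖
      ≤ δ⁻¹ * ∫ v, ‖remainder h w x v‖ ∂(surface n) := by
        gcongr; exact norm_integral_le_integral_norm _
    _ = ∫ v, δ⁻¹ * ‖remainder h w x v‖ ∂(surface n) := (integral_const_mul _ _).symm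
    _ ≤ ∫ v : Sph n, (K1 * (Iic (3 * δ)).indicator (weakSingularity n) ‖(x : Ambient n) - v‖ +
        (K1 + K2) * (Iic (2 * δ)).indicator (weakSingularity n) ‖(w : Ambient n) - v‖) + far x v
          ∂(surface n) := by
        refine integral_mono ((hri x).norm.const_mul _) (i3.add (hfari x)) fun v => ?_
        have ws : ∀ (s : Set ℝ) (y : Ambient n), 0 ≤ s.indicator (weakSingularity n) ‖y‖ :=
          fun s y => by
            by_cases hs : ‖y‖ ∈ s
            · rw [indicator_of_mem hs]; exact weakSingularity_nonneg (norm_nonneg _)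
            · rw [indicator_of_notMem hs]
        by_cases hv : 2 * δ < ‖(w : Ambient n) - v‖
        · have : far x v = δ⁻¹ * ‖remainder h w x v‖ := indicator_of_mem (by exact hv) _
          simp only
          rw [this]
          refine le_add_of_nonneg_left (add_nonneg (mul_nonneg hK1p (ws _ _))
            (mul_nonneg (by positivity) (ws _ _)))
        · have hf : far x v = 0 := indicator_of_notMem (by exact hv) _
          have hv' := not_lt.mp hv
          -- The radius `3δ` is `δ + 2δ`: the near cap around `w` lies in this cap around `x`.
          have hxv : ‖(x : Ambient n) - v‖ ≤ 3 * δ := by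
            have := norm_sub_le_norm_sub_add_norm_sub (x : Ambient n) w v
            linarith
          simp only
          rw [hf, add_zero, indicator_of_mem (mem_Iic.mpr hxv), indicator_of_mem (mem_Iic.mpr hv')]
          have wx := weakSingularity_nonneg (n := n) (norm_nonneg ((x : Ambient n) - v))
          have ww := weakSingularity_nonneg (n := n) (norm_nonneg ((w : Ambient n) - v))
          rcases (norm_nonneg ((x : Ambient n) - w)).eq_or_lt with h0 | h0
          · rw [hδdef, ← h0, inv_zero, zero_mul]; positivity
          · rw [inv_mul_le_iff₀ h0, mul_comm δ]
            refine (norm_remainder_near_le hC0 hC hv').trans_eq ?_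
            ring
    _ = _ := by
        rw [integral_add i3 (hfari x), integral_add i1 i2, integral_const_mul,
          integral_const_mul, hcapx]
        rfl

/-! ### First-order bounds for `C¹` functions on the sphere -/

/-- The chart at `w` is stereographic projection from `-w`, whose formula makes sense and is smooth
on an ambient neighbourhood of `w`; composing with the chart expression of `f` extends it. Only the
pole `-w` is outside the chart. -/
theorem exists_differentiableAt_extension {n : ℕ} {f : Sph n → Cl n} {w : Sph n}
    (hf : MDifferentiableAt (𝓡 n) 𝓘(ℝ, Cl n) f w) :
    ∃ F : Ambient n → Cl n, DifferentiableAt ℝ F (w : Ambient n) ∧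
      ∀ v : Sph n, v ≠ -w → F v = f v := by
  have : Fact (Module.finrank ℝ (Ambient n) = n + 1) := ⟨finrank_euclideanSpace_fin⟩
  set ψ := writtenInExtChartAt (𝓡 n) 𝓘(ℝ, Cl n) w f with hψ
  have hψd : DifferentiableAt ℝ ψ (extChartAt (𝓡 n) w w) := by
    have := hf.differentiableWithinAt_writtenInExtChartAt
    simpa only [modelWithCornersSelf_coe, range_id, differentiableWithinAt_univ] using this
  have hw1 : ‖((-w : Sph n) : Ambient n)‖ = 1 := norm_eq_of_mem_sphere _
  set U := (OrthonormalBasis.fromOrthogonalSpanSingleton (𝕜 := ℝ) n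
    (ne_zero_of_mem_unit_sphere (-w))).repr with hU
  have hchart : ∀ v : Sph n, extChartAt (𝓡 n) w v =
      U (stereoToFun ((-w : Sph n) : Ambient n) (v : Ambient n)) := fun v => by
    rfl
  refine ⟨fun x => ψ (U (stereoToFun ((-w : Sph n) : Ambient n) x)), ?_, fun v hv => ?_⟩
  · have hs : DifferentiableAt ℝ (stereoToFun ((-w : Sph n) : Ambient n)) (w : Ambient n) := by
      refine ((contDiffOn_stereoToFun (n := 1)).contDiffAt ?_).differentiableAt one_ne_zero
      refine IsOpen.mem_nhds (isOpen_ne_fun (by fun_prop) continuous_const) ?_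
      simp only [mem_ofPred_eq, innerSL_apply_apply, coe_neg_sphere, inner_neg_left,
        inner_self_sphere]
      norm_num
    refine DifferentiableAt.comp (w : Ambient n) (g := ψ) ?_
      (U.toContinuousLinearEquiv.differentiableAt.comp _ hs)
    rw [hchart w] at hψd
    exact hψd
  · simp only
    rw [← hchart, hψ, writtenInExtChartAt]
    simp only [Function.comp_apply, extChartAt_model_space_eq_id, PartialEquiv.refl_coe, id]
    rw [(extChartAt (𝓡 n) w).left_inv]
    rw [extChartAt_source]
    change v ∈ (stereographic' n (-w)).source
    rw [stereographic'_source]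
    exact hv

theorem exists_lipschitz_at {n : ℕ} {f : Sph n → Cl n}
    (hf : ContMDiff (𝓡 n) 𝓘(ℝ, Cl n) 1 f) (w : Sph n) :
    ∃ C : ℝ, 0 ≤ C ∧ ∀ v : Sph n, ‖f v - f w‖ ≤ C * ‖(w : Ambient n) - v‖ := by
  obtain ⟨F, hF, hFf⟩ := exists_differentiableAt_extension (hf.mdifferentiableAt one_ne_zero (x := w))
  have hne : ∀ᶠ v in 𝓝 w, v ≠ -w :=
    isOpen_ne.mem_nhds (ne_neg_of_mem_unit_sphere ℝ w)
  have hO := hF.isBigO_sub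
  obtain ⟨C, hC⟩ := hO.bound
  have hC' := continuous_subtype_val.continuousAt.eventually hC
  obtain ⟨ε, hε, hball⟩ := Metric.eventually_nhds_iff.mp (hC'.and hne)
  obtain ⟨D, hD⟩ := isCompact_univ.exists_bound_of_continuousOn hf.continuous.continuousOn
  have hD0 : 0 ≤ D := (norm_nonneg _).trans (hD w (mem_univ _))
  have hww : w ≠ -w := hne.self_of_nhds
  -- `C` works near `w`; at distance at least `ε` the bound `2D` on the difference is enough.
  refine ⟨max C (2 * D / ε), le_max_of_le_right (by positivity), fun v => ?_⟩
  by_cases hv : dist v w < ε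
  · obtain ⟨h1, h2⟩ := hball hv
    rw [hFf v h2, hFf w hww, norm_sub_rev (v : Ambient n)] at h1
    exact h1.trans (by gcongr; exact le_max_left _ _)
  · have h1 : ε ≤ ‖(w : Ambient n) - v‖ := by
      rw [dist_comm, Subtype.dist_eq, dist_eq_norm] at hv
      exact not_lt.mp hv
    calc ‖f v - f w‖ ≤ D + D :=
          (norm_sub_le _ _).trans (add_le_add (hD v (mem_univ _)) (hD w (mem_univ _)))
      _ = 2 * D / ε * ε := by field_simp; ring
      _ ≤ _ := by gcongr; exact le_max_right _ _

/-! ### Tangential derivatives and part (1) -/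

/-- The orthogonal projection on the tangent space of the sphere at `w`. -/
def tangentProj {n : ℕ} (w : Ambient n) : Ambient n →L[ℝ] Ambient n :=
  ContinuousLinearMap.id ℝ _ - (innerSL ℝ w).smulRight w

theorem tangentProj_apply {n : ℕ} (w τ : Ambient n) : tangentProj w τ = perp w τ := rfl

theorem perp_self {n : ℕ} (w : Sph n) : perp (w : Ambient n) w = 0 := by
  rw [perp, inner_self_sphere, one_smul, sub_self]

theorem hasFDerivAt_normalize {n : ℕ} (w : Sph n) :
    HasFDerivAt (fun x : Ambient n => ‖x‖⁻¹ • x) (tangentProj (w : Ambient n)) (w : Ambient n) := by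
  have hw : ‖(w : Ambient n)‖ = 1 := norm_eq_of_mem_sphere w
  have h1 : HasFDerivAt (fun x : Ambient n => ‖x‖) (innerSL ℝ (w : Ambient n)) (w : Ambient n) := by
    have h := (hasStrictFDerivAt_norm_sq (w : Ambient n)).hasFDerivAt.sqrt (by simp)
    simp only [Real.sqrt_sq (norm_nonneg _), hw] at h
    refine h.congr_fderiv ?_
    rw [← Nat.cast_smul_eq_nsmul ℝ, smul_smul]
    norm_num
  have h2 : HasDerivAt (fun u : ℝ => u⁻¹) (-1) ‖(w : Ambient n)‖ := by
    simpa [hw] using hasDerivAt_inv (x := ‖(w : Ambient n)‖) (by simp)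
  refine ((h2.comp_hasFDerivAt (w : Ambient n) h1).smul (hasFDerivAt_id _)).congr_fderiv ?_
  ext1 τ
  simp [tangentProj, hw, sub_eq_add_neg]

/-- Chain rule through `x ↦ x / ‖x‖`, which takes values in the sphere: a derivative within the
sphere is therefore enough, and its arbitrary normal component is removed by the projection. -/
theorem hasFDerivAt_radialExt {n : ℕ} {F : Ambient n → Cl n} {F' : Ambient n →L[ℝ] Cl n}
    {g : Sph n → Cl n} {w : Sph n} (hF : HasFDerivWithinAt F F' (sphere 0 1) (w : Ambient n))
    (hFg : ∀ u : Sph n, F u = g u) :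
    HasFDerivAt (radialExt g) (F'.comp (tangentProj (w : Ambient n))) (w : Ambient n) := by
  have hN := hasFDerivAt_normalize w
  have hw : ‖(w : Ambient n)‖⁻¹ • (w : Ambient n) = w := by simp
  have hne : ∀ᶠ x : Ambient n in 𝓝 (w : Ambient n), x ≠ 0 :=
    isOpen_ne.mem_nhds (ne_zero_of_mem_unit_sphere w)
  have hmem : ∀ x : Ambient n, x ≠ 0 → ‖x‖⁻¹ • x ∈ sphere (0 : Ambient n) 1 := fun x hx => by
    rw [mem_sphere_zero_iff_norm, norm_smul, norm_inv, norm_norm,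
      inv_mul_cancel₀ (norm_ne_zero_iff.mpr hx)]
  rw [← hw] at hF
  have hcomp : HasFDerivAt (F ∘ fun x : Ambient n => ‖x‖⁻¹ • x)
      (F'.comp (tangentProj (w : Ambient n))) (w : Ambient n) :=
    HasFDerivWithinAt.comp_hasFDerivAt (f := fun x : Ambient n => ‖x‖⁻¹ • x) (w : Ambient n)
      hF hN (hne.mono hmem)
  refine hcomp.congr_of_eventuallyEq ?_
  filter_upwards [hne] with x hx
  rw [radialExt, dif_neg hx, ← hFg]
  rfl

theorem diracSymbol_comp_tangentProj {n : ℕ} (L : Ambient n →L[ℝ] Cl n) (w : Ambient n) :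
    diracSymbol (L.comp (tangentProj w)) = diracSymbol L - conj w * L w := by
  have h : ∀ i : Fin (n + 1), conj (EuclideanSpace.single i 1 : Ambient n) *
      (L.comp (tangentProj w)) (EuclideanSpace.single i 1) =
      conj (EuclideanSpace.single i 1 : Ambient n) * L (EuclideanSpace.single i 1) -
      conj (w i • (EuclideanSpace.single i 1 : Ambient n)) * L w := fun i => by
    rw [ContinuousLinearMap.comp_apply, tangentProj_apply, perp,
      EuclideanSpace.inner_single_right, map_sub, map_smul, mul_sub, conj_smul]
    simp
  simp only [diracSymbol, h, Finset.sum_sub_distrib, ← Finset.sum_mul, ← conj_sum, sum_smul_single]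

/-- The radial extension is annihilated by `E`, and its `D̄` is the tangential part of the symbol of
`F'`. -/
theorem piS0_eq {n : ℕ} {F : Ambient n → Cl n} {F' : Ambient n →L[ℝ] Cl n}
    {f : Sph n → Cl n} {w : Sph n} (hF : HasFDerivWithinAt F F' (sphere 0 1) (w : Ambient n))
    (hFg : ∀ u : Sph n, F u = cauchyT f u) :
    piS0 f w = diracSymbol F' - conj (w : Ambient n) * F' w
      + (1 - (n : ℝ) / 2) • (conj (w : Ambient n) * cauchyT f w) := by
  have h := (hasFDerivAt_radialExt hF hFg).fderiv
  have hD : fderiv ℝ (radialExt (cauchyT f)) (w : Ambient n) (w : Ambient n) = 0 := by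
    rw [h, ContinuousLinearMap.comp_apply, tangentProj_apply, perp_self, map_zero]
  rw [piS0, diracSBar, mul_sub, conj_mul_gammaBar, diracBar_eq_diracSymbol, euler_eq, hD, h,
    diracSymbol_comp_tangentProj, mul_zero, sub_zero, mul_smul_comm, sub_smul, one_smul]
  abel

theorem piS0_eq_of_extension {n : ℕ} {F : Ambient n → Cl n} {f : Sph n → Cl n} {w : Sph n}
    (hFg : ∀ u : Sph n, F u = cauchyT f u) (hF : DifferentiableAt ℝ F (w : Ambient n)) :
    piS0 f w = diracBar F w + conj (w : Ambient n) * (F w - euler F w)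
        - ((n : ℝ) / 2) • (conj (w : Ambient n) * F w) := by
  rw [piS0_eq hF.hasFDerivAt.hasFDerivWithinAt hFg, diracBar_eq_diracSymbol, euler_eq, ← hFg,
    sub_smul, one_smul, mul_sub]
  abel

/-! ### The singular kernel as a tangential derivative -/

theorem diracSymbol_conj_comp_tangentProj {n : ℕ} (w : Ambient n) :
    diracSymbol ((conjL n).comp (tangentProj w)) = tangentSymbol w := by
  have h := sum_conj_sq (EuclideanSpace.basisFun (Fin (n + 1)) ℝ)
  rw [diracSymbol_comp_tangentProj, tangentSymbol, pow_two, ← h]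
  simp [diracSymbol]

/-- Differentiating `ȳ` gives the symbol in `A`; differentiating `‖y‖^{-n}` gives `ȳ - ⟨y, w⟩ w̄` on
the left, which for `y = w - v` is minus the conjugate of the tangential part of `v`, the left
factor of `B`. -/
theorem diracSymbol_dKernel_comp_tangentProj {n : ℕ} (w v : Sph n) :
    diracSymbol ((dKernel ((w : Ambient n) - (v : Ambient n))).comp (tangentProj (w : Ambient n))) =
      kernelSum (w : Ambient n) (v : Ambient n) := by
  set y := (w : Ambient n) - (v : Ambient n) with hy
  have hs : ∑ i : Fin (n + 1), (inner ℝ y (EuclideanSpace.single i 1 : Ambient n)) •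
      conj (EuclideanSpace.single i 1 : Ambient n) = conj y := by
    simp only [EuclideanSpace.inner_single_right, conj_trivial, one_mul, ← conj_smul, ← conj_sum,
      sum_smul_single]
  have h1 : diracSymbol (dKernel y) = (‖y‖ ^ n)⁻¹ • diracSymbol (conjL n) -
      (n * (‖y‖ ^ (n + 2))⁻¹) • (conj y * conj y) := by
    have h2 : conj y * conj y = ∑ i : Fin (n + 1),
        (inner ℝ y (EuclideanSpace.single i 1 : Ambient n)) •
          (conj (EuclideanSpace.single i 1 : Ambient n) * conj y) := by
      simp only [← smul_mul_assoc, ← Finset.sum_mul, hs]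
    simp only [h2, diracSymbol, dKernel_apply, mul_sub, Finset.sum_sub_distrib, mul_smul_comm,
      Finset.smul_sum, conjL_apply]
  have h3 : conj y - inner ℝ y (w : Ambient n) • conj (w : Ambient n)
      = - conj (perp (w : Ambient n) v) := by
    rw [← conj_smul, ← conj_sub, ← conj_neg, hy, perp, inner_sub_left, inner_self_sphere,
      real_inner_comm]
    congr 1
    module
  rw [diracSymbol_comp_tangentProj, h1, dKernel_apply, kernelSum, kernelA_eq, kernelB_eq, ← hy,
    ← diracSymbol_conj_comp_tangentProj, diracSymbol_comp_tangentProj, conjL_apply,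
    ← neg_eq_iff_eq_neg.mpr h3, neg_mul, sub_mul]
  simp only [mul_sub, mul_smul_comm, smul_mul_assoc]
  module

/-! ### Principal values and the free term -/

theorem tendsto_integral_outside {n : ℕ} {F : Type*} [NormedAddCommGroup F] [NormedSpace ℝ F]
    {w : Sph n} {g : Sph n → F} (hg : Integrable g (surface n)) (hw : g w = 0) :
    Tendsto (fun ε : ℝ => ∫ v in outside w ε, g v ∂(surface n)) (𝓝[>] 0)
      (𝓝 (∫ v, g v ∂(surface n))) := by
  simp only [← integral_indicator (measurableSet_outside w _)]
  refine tendsto_integral_filter_of_dominated_convergence (fun v => ‖g v‖)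
    (Eventually.of_forall fun ε =>
      hg.aestronglyMeasurable.indicator (measurableSet_outside w ε))
    (Eventually.of_forall fun ε => ae_of_all _ fun v => norm_indicator_le_norm_self _ _)
    hg.norm (ae_of_all _ fun v => ?_)
  by_cases hv : v = w
  · subst hv
    simp [indicator, hw]
  · have hpos : 0 < ‖(w : Ambient n) - v‖ :=
      norm_pos_iff.mpr (sub_ne_zero.mpr fun hh => hv (Subtype.ext hh.symm))
    refine tendsto_const_nhds.congr' ?_
    filter_upwards [Ioo_mem_nhdsGT hpos] with ε hε
    rw [indicator_of_mem (show v ∈ outside w ε from hε.2)]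

theorem diracSymbol_smul {n : ℕ} (c : ℝ) (L : Ambient n →L[ℝ] Cl n) :
    diracSymbol (c • L) = c • diracSymbol L := by
  simp [diracSymbol, Finset.smul_sum]

theorem diracSymbol_add {n : ℕ} (L M : Ambient n →L[ℝ] Cl n) :
    diracSymbol (L + M) = diracSymbol L + diracSymbol M := by
  simp [diracSymbol, mul_add, Finset.sum_add_distrib]

theorem diracSymbol_mul_right {n : ℕ} (L : Ambient n →L[ℝ] Cl n) (c : Cl n) :
    diracSymbol (((mulL n).flip c).comp L) = diracSymbol L * c := by
  simp [diracSymbol, Finset.sum_mul, mul_assoc]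

/-- `diracSymbol` as a continuous linear map. -/
def diracSymbolL (n : ℕ) : (Ambient n →L[ℝ] Cl n) →L[ℝ] Cl n :=
  LinearMap.toContinuousLinearMap
    { toFun := fun L => diracSymbol L
      map_add' := diracSymbol_add
      map_smul' := diracSymbol_smul }

theorem diracSymbol_dIntegrand {n : ℕ} (h : Sph n → Cl n) (w v : Sph n) :
    diracSymbol ((dIntegrand h w v).comp (tangentProj (w : Ambient n))) =
      kernelSum (w : Ambient n) (v : Ambient n) * h v := by
  rw [dIntegrand, ContinuousLinearMap.comp_assoc, diracSymbol_mul_right,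
    diracSymbol_dKernel_comp_tangentProj]

/-- The tangential symbol is a continuous linear map on operators, so it commutes with the integral
of the derivative. -/
theorem integrable_kernelSum_mul {n : ℕ} (hn : 1 ≤ n) {h : Sph n → Cl n} (hcont : Continuous h)
    {w : Sph n} {C : ℝ} (hC : ∀ v : Sph n, ‖h v‖ ≤ C * ‖(w : Ambient n) - v‖) :
    Integrable (fun v : Sph n => kernelSum (w : Ambient n) (v : Ambient n) * h v) (surface n) ∧
    diracSymbol ((∫ v, dIntegrand h w v ∂(surface n)).comp (tangentProj (w : Ambient n))) =
      ∫ v : Sph n, kernelSum (w : Ambient n) (v : Ambient n) * h v ∂(surface n) := by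
  have hdi := integrable_dIntegrand hn hcont hC
  set Λ : (Ambient n →L[ℝ] Cl n) →L[ℝ] Cl n := (diracSymbolL n).comp
    ((ContinuousLinearMap.compL ℝ (Ambient n) (Ambient n) (Cl n)).flip (tangentProj (w : Ambient n)))
  have hΛ : ∀ v, Λ (dIntegrand h w v) = kernelSum (w : Ambient n) (v : Ambient n) * h v :=
    diracSymbol_dIntegrand h w
  refine ⟨?_, ?_⟩
  · simpa only [hΛ] using Λ.integrable_comp hdi
  · have := Λ.integral_comp_comm hdi
    simp only [hΛ] at this
    exact this.symm

/-- After subtracting `f w` from the density, the constant contributes `(2/n) ū f(w)` at `u`, which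
extends linearly to the ambient space. -/
theorem hasFDerivWithinAt_cauchyT {n : ℕ} (hn : 1 ≤ n) {f : Sph n → Cl n} (hf : Continuous f)
    {w : Sph n} {C : ℝ} (hC0 : 0 ≤ C)
    (hC : ∀ v : Sph n, ‖f v - f w‖ ≤ C * ‖(w : Ambient n) - v‖) :
    ∃ F : Ambient n → Cl n, (∀ u : Sph n, F u = cauchyT f u) ∧
      HasFDerivWithinAt F ((omega n)⁻¹ • ∫ v, dIntegrand (fun v => f v - f w) w v ∂(surface n) +
        (2 / n : ℝ) • ((mulL n).flip (f w)).comp (conjL n)) (sphere 0 1) (w : Ambient n) := by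
  have hcont : Continuous fun v => f v - f w := hf.sub continuous_const
  refine ⟨fun x => (omega n)⁻¹ • (∫ v : Sph n, cauchyKernel (x - (v : Ambient n)) *
    (f v - f w) ∂(surface n)) + (2 / n : ℝ) • (((mulL n).flip (f w)).comp (conjL n)) x,
    fun u => ?_, ?_⟩
  · have hi1 := integrable_cauchyKernel hn u hf
    have hi2 := integrable_cauchyKernel hn u (g := fun _ => f w) continuous_const
    have hi3 : Integrable (fun v : Sph n => cauchyKernel ((u : Ambient n) - (v : Ambient n)))
        (surface n) := by
      simpa using integrable_cauchyKernel hn u (g := fun _ => 1) continuous_const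
    simp only [mul_sub]
    rw [integral_sub hi1 hi2, integral_mul_right_clifford hi3, integral_cauchyKernel hn, cauchyT,
      smul_sub, smul_mul_assoc, smul_smul, inv_mul_cancel_left₀ (omega_pos hn).ne']
    simp
  · exact ((hasFDerivWithinAt_cauchyIntegral hn hcont hC0 hC).const_smul (omega n)⁻¹).add
      ((((mulL n).flip (f w)).comp (conjL n)).hasFDerivWithinAt.const_smul (2 / n : ℝ))

theorem tendsto_truncated {n : ℕ} (hn : 1 ≤ n) {f : Sph n → Cl n} (hf : Continuous f)
    {w : Sph n} {C : ℝ} (hC : ∀ v : Sph n, ‖f v - f w‖ ≤ C * ‖(w : Ambient n) - v‖) :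
    Tendsto (fun ε : ℝ => ∫ v in outside w ε, kernelSum (w : Ambient n) (v : Ambient n) * f v
        ∂(surface n)) (𝓝[>] 0)
      (𝓝 ((∫ v : Sph n, kernelSum (w : Ambient n) (v : Ambient n) * (f v - f w) ∂(surface n)) +
        (omega n / n) • (tangentSymbol (w : Ambient n) * f w))) := by
  have hcont : Continuous fun v => f v - f w := hf.sub continuous_const
  have hKi := (integrable_kernelSum_mul hn hcont hC).1
  have hJ := integral_norm_sub_sq_div hn w
  have hJi := integrable_norm_sub_sq_div hn w
  have h1 := tendsto_integral_outside (w := w) hKi (by rw [sub_self, mul_zero])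
  have h2 := tendsto_integral_outside (w := w) hJi (by simp)
  rw [hJ] at h2
  have h3 : Tendsto (fun ε : ℝ => ((1 / 4) * ∫ v in outside w ε,
      ‖(w : Ambient n) - v‖ ^ 2 * (‖(w : Ambient n) - v‖ ^ n)⁻¹ ∂(surface n)) •
        (tangentSymbol (w : Ambient n) * f w)) (𝓝[>] 0)
      (𝓝 ((omega n / n) • (tangentSymbol (w : Ambient n) * f w))) := by
    have := (h2.const_mul (1 / 4)).smul_const (tangentSymbol (w : Ambient n) * f w)
    rwa [show 1 / 4 * (omega n * (4 / n)) = omega n / n by ring] at this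
  refine (h1.add h3).congr' ?_
  filter_upwards [self_mem_nhdsWithin] with ε hε
  have hAi := integrableOn_kernelA w hε (g := fun _ => 1) continuous_const
  have hBi := integrableOn_kernelB w hε (g := fun _ => 1) continuous_const
  simp only [mul_one] at hAi hBi
  have hSi : IntegrableOn (fun v : Sph n => kernelSum (w : Ambient n) (v : Ambient n))
      (outside w ε) (surface n) := hAi.add (hBi.smul (n : ℝ))
  have hSc : IntegrableOn (fun v : Sph n => kernelSum (w : Ambient n) (v : Ambient n) * f w)
      (outside w ε) (surface n) := ((mulL n).flip (f w)).integrable_comp hSi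
  -- Away from the pole the kernel is integrable, so the parts with `f v - f w` and with `f w` may
  -- be recombined.
  rw [← smul_mul_assoc, ← integral_outside_kernelSum hn w hε, ← integral_mul_right_clifford hSi,
    ← integral_add hKi.integrableOn hSc]
  simp only [← mul_add, sub_add_cancel]

theorem piS0_eq_limit {n : ℕ} (hn : 1 ≤ n) {f : Sph n → Cl n} (hf : Continuous f)
    {w : Sph n} {C : ℝ} (hC0 : 0 ≤ C)
    (hC : ∀ v : Sph n, ‖f v - f w‖ ≤ C * ‖(w : Ambient n) - v‖) :
    piS0 f w = (omega n)⁻¹ •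
        ((∫ v : Sph n, kernelSum (w : Ambient n) (v : Ambient n) * (f v - f w) ∂(surface n)) +
        (omega n / n) • (tangentSymbol (w : Ambient n) * f w))
      + (1 - (n : ℝ) / 2) • (conj (w : Ambient n) * cauchyT f w)
      + (n : ℝ)⁻¹ • (tangentSymbol (w : Ambient n) * f w) := by
  have hn' : (n : ℝ) ≠ 0 := by exact_mod_cast (by omega : n ≠ 0)
  have hω := (omega_pos hn).ne'
  obtain ⟨F, hF, hF'⟩ := hasFDerivWithinAt_cauchyT hn hf hC0 hC
  have hcont : Continuous fun v => f v - f w := hf.sub continuous_const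
  -- The constant density contributes `2/n = 1/n + 1/n`: one half belongs to the limit of the
  -- truncated integrals, the other is the free term.
  rw [piS0_eq hF' hF, ← diracSymbol_comp_tangentProj, ContinuousLinearMap.add_comp,
    ContinuousLinearMap.smul_comp, ContinuousLinearMap.smul_comp, diracSymbol_add,
    diracSymbol_smul, diracSymbol_smul, ContinuousLinearMap.comp_assoc, diracSymbol_mul_right,
    diracSymbol_conj_comp_tangentProj,
    (integrable_kernelSum_mul hn hcont hC).2, smul_add, smul_smul,
    inv_mul_eq_div, div_div_cancel_left' hω, div_eq_mul_inv, mul_smul, two_smul]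
  abel

end SphericalPi

end

theorem mainTheorem9 (n : ℕ) (hn : 1 ≤ n) (f : SphericalPi.Sph n → SphericalPi.Cl n)
    (hf : ContMDiff (𝓡 n) 𝓘(ℝ, SphericalPi.Cl n) 1 f) (w : SphericalPi.Sph n) :
    -- `T f` is given by an absolutely convergent integral and is differentiable
    MeasureTheory.Integrable
      (fun v : SphericalPi.Sph n =>
        SphericalPi.cauchyKernel ((w : SphericalPi.Ambient n) - (v : SphericalPi.Ambient n)) * f v)
      (SphericalPi.surface n) ∧
    DifferentiableAt ℝ (SphericalPi.radialExt (SphericalPi.cauchyT f))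
      (w : SphericalPi.Ambient n) ∧
    -- `Π f = (D̄₀ T + w̄ (1 - E) T - (n/2) w̄ T) f`, for every differentiable extension of `T f`
    (∀ F : SphericalPi.Ambient n → SphericalPi.Cl n,
      (∀ u : SphericalPi.Sph n, F u = SphericalPi.cauchyT f u) →
      DifferentiableAt ℝ F (w : SphericalPi.Ambient n) →
      SphericalPi.piS0 f w =
        SphericalPi.diracBar F w
        + SphericalPi.conj (w : SphericalPi.Ambient n) * (F w - SphericalPi.euler F w)
        - ((n : ℝ) / 2) • (SphericalPi.conj (w : SphericalPi.Ambient n) * F w)) ∧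
    -- the truncated singular integrals converge absolutely
    (∀ ε : ℝ, 0 < ε →
      MeasureTheory.IntegrableOn (fun v : SphericalPi.Sph n => SphericalPi.kernelA (n := n) w v * f v)
        (SphericalPi.outside w ε) (SphericalPi.surface n) ∧
      MeasureTheory.IntegrableOn (fun v : SphericalPi.Sph n => SphericalPi.kernelB (n := n) w v * f v)
        (SphericalPi.outside w ε) (SphericalPi.surface n)) ∧
    -- the principal value exists, and the integral expression holds
    ∃ L : SphericalPi.Cl n,
      Filter.Tendsto
        (fun ε : ℝ =>
          (SphericalPi.omega n)⁻¹ •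
            (∫ v in SphericalPi.outside w ε,
              SphericalPi.kernelA (n := n) w v * f v ∂(SphericalPi.surface n))
          + ((n : ℝ) / SphericalPi.omega n) •
            (∫ v in SphericalPi.outside w ε,
              SphericalPi.kernelB (n := n) w v * f v ∂(SphericalPi.surface n)))
        (𝓝[>] (0 : ℝ)) (𝓝 L) ∧
      SphericalPi.piS0 f w =
        L
        + (1 - (n : ℝ) / 2) • (((SphericalPi.omega n)⁻¹ •
            SphericalPi.conj (w : SphericalPi.Ambient n)) *
            ∫ v : SphericalPi.Sph n,
              SphericalPi.cauchyKernel ((w : SphericalPi.Ambient n) - (v : SphericalPi.Ambient n)) * f v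
                ∂(SphericalPi.surface n))
        + ((n : ℝ)⁻¹ • (algebraMap ℝ (SphericalPi.Cl n) (1 - n)
            - SphericalPi.conj (w : SphericalPi.Ambient n) ^ 2)) * f w := by
  have hfc := hf.continuous
  obtain ⟨C, hC0, hC⟩ := SphericalPi.exists_lipschitz_at hf w
  refine ⟨SphericalPi.integrable_cauchyKernel hn w hfc, ?_,
    fun F hF hFd => SphericalPi.piS0_eq_of_extension hF hFd,
    fun ε hε => ⟨SphericalPi.integrableOn_kernelA w hε hfc,
      SphericalPi.integrableOn_kernelB w hε hfc⟩, _,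
    ((SphericalPi.tendsto_truncated hn hfc hC).const_smul (SphericalPi.omega n)⁻¹).congr' ?_, ?_⟩
  · obtain ⟨F, hF, hF'⟩ := SphericalPi.hasFDerivWithinAt_cauchyT hn hfc hC0 hC
    exact (SphericalPi.hasFDerivAt_radialExt hF' hF).differentiableAt
  · filter_upwards [self_mem_nhdsWithin] with ε hε
    have hA := SphericalPi.integrableOn_kernelA w hε hfc
    have hB := SphericalPi.integrableOn_kernelB w hε hfc
    simp only [SphericalPi.kernelSum, add_mul, smul_mul_assoc]
    rw [MeasureTheory.integral_add hA (hB.fun_smul (n : ℝ)), MeasureTheory.integral_smul, smul_add,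
      smul_smul, inv_mul_eq_div]
  · rw [SphericalPi.piS0_eq_limit hn hfc hC0 hC, SphericalPi.cauchyT, smul_mul_assoc,
      smul_mul_assoc, mul_smul_comm]
    rfl
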